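/- **Setting.** Let $S$ (states) and $A$ (actions) be finite, $P(s'\mid s,a)$ a transition model, $\mu_0$ the law of the first state, and $\boldsymbol l_1,\dots,\boldsymbol l_L\in[0,1]^{S\times A}$ loss vectors with convex hull $\Delta_L$. A policy $\pi$ assigns to each state a distribution on $A$, and $P(\pi)_{s,s'}=\sum_a\pi(a|s)P(s'|s,a)$. Assume that for some $\tau>0$, all policies $\pi$ and all distributions $d,d'$ on $S$, $\|dP(\pi)-d'P(\pi)\|_1\le e^{-1/\tau}\|d-d'\|_1$. Let $\boldsymbol d_\pi$ be the stationary (state, action) distribution of $\pi$, let $\Delta_{\boldsymbol d_\Pi}$ be the convex hull of the $\boldsymbol d_\pi$ with $\pi$ deterministic, and let $Q_{\pi,\boldsymbol l}(s,a)=\mathbb E\big[\sum_{t\ge1}(\boldsymbol l(s_t,a_t)-\langle \boldsymbol l,\boldsymbol d_\pi\rangle)\mid s_1=s,a_1=a,\pi\big]$, understood as the sum of the expectations of its terms. In round $t$ the agent uses a policy $\pi_t$ and the adversary chooses $\boldsymbol l_t=\boldsymbol l_t^{\pi_1,\dots,\pi_{t-1}}\in\Delta_L$ as a function of $\pi_1,\dots,\pi_{t-1}$;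 $\boldsymbol l_t^{\pi}$ denotes its choice when the agent uses the fixed policy $\pi$ in every round. Let $\boldsymbol v_t$ (resp. $\boldsymbol v_t^\pi$) be the law of the (state, action) pair in round $t$ under $\pi_1,\pi_2,\dots$ (resp. under $\pi$ in every round), started from $\mu_0$. The policy regret of the agent is $R_T(\pi)=\sum_{t\le T}\langle\boldsymbol l_t,\boldsymbol v_t\rangle-\sum_{t\le T}\langle\boldsymbol l_t^{\pi},\boldsymbol v_t^{\pi}\rangle$. The adversary is *no-regret* if for every sequence of policies of the agent $\limsup_{T\to\infty}\max_{\boldsymbol l\in\Delta_L}\frac1T\sum_{t\le T}\langle \boldsymbol l-\boldsymbol l_t,\boldsymbol v_t\rangle\le0$, or if this holds for every sequence with $\boldsymbol d_{\pi_t}$ in place of $\boldsymbol v_t$; it is *uniformly no-regret* if one of these holds uniformly over all sequences of policies. For $\epsilon\ge0$, a pair $(\boldsymbol l,\boldsymbol d)\in\Delta_L\times\Delta_{\boldsymbol d_\Pi}$ is an $\epsilon$-Nash equilibrium if $\max_{\boldsymbol l'\in\Delta_L}\langle \boldsymbol l',\boldsymbol d\rangle-\epsilon\le\langle \boldsymbol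 l,\boldsymbol d\rangle\le\min_{\boldsymbol d'\in\Delta_{\boldsymbol d_\Pi}}\langle \boldsymbol l,\boldsymbol d'\rangle+\epsilon$. **Algorithm (MDP-OOE with an $\epsilon$-best response oracle).** The agent keeps effective action sets $A^s_t\subseteq A$, $s\in S$, starting from arbitrary sets $A^s_0$. In round $t$ the oracle returns a deterministic policy $b_t$ with $\langle\bar{\boldsymbol l},\boldsymbol d_{b_t}\rangle\le\min_\pi\langle\bar{\boldsymbol l},\boldsymbol d_\pi\rangle+\epsilon$, where $\bar{\boldsymbol l}$ is the average of the losses observed so far in the current time window ($\bar{\boldsymbol l}=0$ in the first round). If $b_t(s)\in A^s_{t-1}$ for all $s$, the sets are kept. Otherwise a new time window starts with round $t$: in every state $s$, $b_t(s)$ is added to $A^s_{t-1}$ if it is not in it, and otherwise an arbitrary (e.g. random) action of $A\setminus A^s_{t-1}$ is added, if there is one. The agent then plays, in each state, multiplicative weights on $A^s_t$ with the feedback accumulated in the current window: for $a\in A_t^s$, $\pi_t(a|s)\propto\exp\big(-\mu\sum_i Q_{\pi_i,\boldsymbol l_i}(s,a)\big)$, the sum being over the earlier rounds $i$ of the window,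 with $\mu=c\sqrt{\log|A^s_t|/n}$ in the $n$-th round of the window, where $c>0$ is a fixed constant; $\pi_t(a|s)=0$ for $a\notin A^s_t$. **Theorem.** Let $\epsilon\ge0$, and let the agent follow MDP-OOE with an $\epsilon$-best response oracle. For every outcome of the choices of additional actions: 1. If the adversary is no-regret, the average strategies $\bar{\boldsymbol l}_T=\frac1T\sum_{t\le T}\boldsymbol l_t$ and $\bar{\boldsymbol d}_T=\frac1T\sum_{t\le T}\boldsymbol d_{\pi_t}$ converge to $\epsilon$-Nash equilibrium: for every $\delta>0$ and all sufficiently large $T$, $(\bar{\boldsymbol l}_T,\bar{\boldsymbol d}_T)$ is an $(\epsilon+\delta)$-Nash equilibrium and lies within distance $\delta$ of an $\epsilon$-Nash equilibrium. 2. The algorithm has $\epsilon$-regret. Against every adversary, $\limsup_{T\to\infty}\max_{\pi}\frac1T\sum_{t\le T}\langle\boldsymbol l_t,\boldsymbol d_{\pi_t}-\boldsymbol d_\pi\rangle\le\epsilon$. If the adversary is no-regret, the policy regret satisfies $\limsup_{T\to\infty}\frac1T R_T(\pi)\le\epsilon$ for every policy $\pi$; if the adversary is uniformly no-regret, then $\limsup_{T\to\infty}\sup_\pi\frac1T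 R_T(\pi)\le\epsilon$. -/

import Mathlib

open Filter Topology
open scoped Matrix

noncomputable section

/-- A stationary (randomised) policy: a probability vector over actions for every state. -/
abbrev Policy (S A : Type*) [Fintype A] : Type _ := S → stdSimplex ℝ A

/-- An online Markov decision process with finite state space `S`, finite action set `A`,
a fixed transition model, an initial state distribution, and `L` loss vectors with entries
in `[0,1]` that the adversary may mix. -/
structure OMDP (S A : Type*) [Fintype S] [Fintype A] (L : ℕ) where
  /-- `P s a s'` is the probability of moving from `s` to `s'` under action `a`. -/
  P : S → A → stdSimplex ℝ S
  /-- The distribution of the first state. -/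
  init : stdSimplex ℝ S
  /-- The loss vectors of the adversary. -/
  lossVec : Fin L → S × A → ℝ
  lossVec_mem : ∀ i x, lossVec i x ∈ Set.Icc (0 : ℝ) 1

namespace OMDP

variable {S A : Type*} [Fintype S] [Fintype A] {L : ℕ} (M : OMDP S A L)

/-- The set of mixtures of the loss vectors. -/
def lossSimplex : Set (S × A → ℝ) := convexHull ℝ (Set.range M.lossVec)

/-- The state transition matrix induced by a policy. -/
def transMat (π : Policy S A) : Matrix S S ℝ := fun s s' => ∑ a, π s a * M.P s a s'

/-- The mixing time assumption with constant `τ`. -/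
def Mixing (τ : ℝ) : Prop :=
  ∀ (π : Policy S A) (ρ ρ' : stdSimplex ℝ S),
    ∑ s, |((ρ : S → ℝ) ᵥ* M.transMat π) s - ((ρ' : S → ℝ) ᵥ* M.transMat π) s|
      ≤ Real.exp (-1 / τ) * ∑ s, |ρ s - ρ' s|

/-- The law of the state in round `t` (rounds are numbered from `0`) when the first state has
law `ρ` and policy `π i` is used in round `i`. -/
def stateLaw (ρ : S → ℝ) (π : ℕ → Policy S A) : ℕ → S → ℝ
  | 0 => ρ
  | t + 1 => stateLaw ρ π t ᵥ* M.transMat (π t)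

/-- The law of a (state, action) pair when the state has law `ρ` and the action is drawn
from `π`. -/
def jointLaw (ρ : S → ℝ) (π : Policy S A) : S × A → ℝ := fun x => ρ x.1 * π x.1 x.2

/-- `v_t(x,a)`: the probability that the (state, action) pair in round `t` is `(x,a)`. -/
def visit (π : ℕ → Policy S A) (t : ℕ) : S × A → ℝ :=
  jointLaw (M.stateLaw M.init π t) (π t)

open Classical in
/-- The stationary state distribution of a policy, which exists and is unique under the
mixing assumption. -/
def statState (π : Policy S A) : S → ℝ :=
  if h : ∃ ρ ∈ stdSimplex ℝ S, ρ ᵥ* M.transMat π = ρ then h.choose else 0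

/-- `d_π`: the stationary (state, action) distribution of a policy. -/
def statDist (π : Policy S A) : S × A → ℝ := jointLaw (M.statState π) π

open Classical in
/-- The deterministic policy given by a map from states to actions. -/
def detPolicy (b : S → A) : Policy S A := fun s =>
  ⟨Pi.single (b s) 1, single_mem_stdSimplex ℝ (b s)⟩

/-- The convex hull of the stationary distributions of all deterministic policies. -/
def statSimplex : Set (S × A → ℝ) :=
  convexHull ℝ (Set.range fun b : S → A => M.statDist (detPolicy b))

/-- The accumulated loss
`Q_{π,l}(s,a) = E[∑_t (l(s_t,a_t) - ⟨l, d_π⟩) | s_1 = s, a_1 = a, π]`: the first step uses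
`(s,a)`, the second state has law `P s a`, and `π` is followed from then on. -/
def accLoss (π : Policy S A) (l : S × A → ℝ) (s : S) (a : A) : ℝ :=
  (l (s, a) - l ⬝ᵥ M.statDist π) +
    ∑' n : ℕ, (l ⬝ᵥ jointLaw (M.stateLaw (M.P s a) (fun _ => π) n) π - l ⬝ᵥ M.statDist π)

/-- A deterministic policy `b` is an `ε`-best response to the loss `l`. -/
def IsEpsBestResponse (ε : ℝ) (l : S × A → ℝ) (b : S → A) : Prop :=
  ∀ π : Policy S A, l ⬝ᵥ M.statDist (detPolicy b) ≤ l ⬝ᵥ M.statDist π + ε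

/-- `(l, d)` is an `ε`-Nash equilibrium of the zero-sum game with payoff `⟨l, d⟩`. -/
def IsEpsNash (ε : ℝ) (l d : S × A → ℝ) : Prop :=
  l ∈ M.lossSimplex ∧ d ∈ M.statSimplex ∧
    (∀ l' ∈ M.lossSimplex, l' ⬝ᵥ d - ε ≤ l ⬝ᵥ d) ∧
    (∀ d' ∈ M.statSimplex, l ⬝ᵥ d ≤ l ⬝ᵥ d' + ε)

/-- A non-oblivious adversary: the loss of round `t` is a mixture of the loss vectors that
depends on the policies of the agent in the earlier rounds. -/
structure Adversary where
  choose : (t : ℕ) → (Fin t → Policy S A) → S × A → ℝ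
  choose_mem : ∀ t h, choose t h ∈ M.lossSimplex

variable {M}

/-- The loss function of round `t` when the agent uses the policies `π 0, π 1, …`. -/
def Adversary.loss (adv : M.Adversary) (π : ℕ → Policy S A) (t : ℕ) : S × A → ℝ :=
  adv.choose t fun i => π i

/-- The external regret of the adversary after `T` rounds against the fixed loss `l`. -/
def Adversary.regret (adv : M.Adversary) (π : ℕ → Policy S A) (T : ℕ) (l : S × A → ℝ) : ℝ :=
  ∑ t ∈ Finset.range T, l ⬝ᵥ M.visit π t - ∑ t ∈ Finset.range T, adv.loss π t ⬝ᵥ M.visit π t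

/-- The external regret of the adversary with respect to the stationary distributions of the
policies of the agent. -/
def Adversary.statRegret (adv : M.Adversary) (π : ℕ → Policy S A) (T : ℕ)
    (l : S × A → ℝ) : ℝ :=
  ∑ t ∈ Finset.range T, l ⬝ᵥ M.statDist (π t) -
    ∑ t ∈ Finset.range T, adv.loss π t ⬝ᵥ M.statDist (π t)

/-- The adversary is no-regret: for every sequence of policies its average external regret is
asymptotically at most `0`, either for the actual play or for the stationary distributions. -/
def Adversary.NoRegret (adv : M.Adversary) : Prop :=
  (∀ π : ℕ → Policy S A, ∀ δ > 0, ∀ᶠ T : ℕ in atTop, ∀ l ∈ M.lossSimplex,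
      adv.regret π T l ≤ δ * T) ∨
  (∀ π : ℕ → Policy S A, ∀ δ > 0, ∀ᶠ T : ℕ in atTop, ∀ l ∈ M.lossSimplex,
      adv.statRegret π T l ≤ δ * T)

/-- The same, uniformly over all sequences of policies (such as a bound `√(T log L / 2)`). -/
def Adversary.UniformNoRegret (adv : M.Adversary) : Prop :=
  (∀ δ > 0, ∀ᶠ T : ℕ in atTop, ∀ π : ℕ → Policy S A, ∀ l ∈ M.lossSimplex,
      adv.regret π T l ≤ δ * T) ∨
  (∀ δ > 0, ∀ᶠ T : ℕ in atTop, ∀ π : ℕ → Policy S A, ∀ l ∈ M.lossSimplex,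
      adv.statRegret π T l ≤ δ * T)

/-- The regret of the agent after `T` rounds against the fixed policy `π₀`, with respect to
stationary distributions. -/
def Adversary.agentStatRegret (adv : M.Adversary) (π : ℕ → Policy S A) (T : ℕ)
    (π₀ : Policy S A) : ℝ :=
  ∑ t ∈ Finset.range T, adv.loss π t ⬝ᵥ M.statDist (π t) -
    ∑ t ∈ Finset.range T, adv.loss π t ⬝ᵥ M.statDist π₀

/-- The policy regret of the agent after `T` rounds: its expected total loss minus the expected
total loss of the fixed policy `π₀` against the losses that the adversary chooses when facing
`π₀` in every round. -/
def Adversary.policyRegret (adv : M.Adversary) (π : ℕ → Policy S A) (T : ℕ)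
    (π₀ : Policy S A) : ℝ :=
  ∑ t ∈ Finset.range T, adv.loss π t ⬝ᵥ M.visit π t -
    ∑ t ∈ Finset.range T, adv.loss (fun _ => π₀) t ⬝ᵥ M.visit (fun _ => π₀) t

/-- The average strategy of the adversary over the first `T` rounds. -/
def Adversary.avgLoss (adv : M.Adversary) (π : ℕ → Policy S A) (T : ℕ) : S × A → ℝ :=
  (T : ℝ)⁻¹ • ∑ t ∈ Finset.range T, adv.loss π t

variable (M)

/-- The average strategy of the agent over the first `T` rounds. -/
def avgStat (π : ℕ → Policy S A) (T : ℕ) : S × A → ℝ :=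
  (T : ℝ)⁻¹ • ∑ t ∈ Finset.range T, M.statDist (π t)

end OMDP

/-- Multiplicative weights over the finite set `B` of experts, with learning rate `μ` and
cumulative feedback `K`: uniform if `K = 0`; each new feedback vector `k` multiplies the weight
of expert `a` by `exp (-μ * k a)` as long as `μ` is kept. -/
def mwu {A : Type*} [DecidableEq A] (B : Finset A) (μ : ℝ) (K : A → ℝ) (a : A) : ℝ :=
  if a ∈ B then Real.exp (-μ * K a) / ∑ b ∈ B, Real.exp (-μ * K b) else 0

/-- A run of MDP-Online Oracle Expert with an `ε`-best response oracle against `adv`.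
Rounds are numbered from `0`. In round `t` the oracle answers `br t`, the effective sets
`E t` of the previous round (the initial ones if `t = 0`) are replaced by `E (t + 1)`, the
current time window starts at round `w (t + 1)` (`w t` before the replacement), and the agent
plays `π t`. The learning rate in the `n`-th round of a window (`n ≥ 1`) in a state with `j`
effective actions is `c * √(log j / n)`. The random choice of an additional action is left
arbitrary, so that every outcome of it is a run. -/
structure IsMDPOOE {S A : Type*} [Fintype S] [Fintype A] [DecidableEq A] {L : ℕ}
    (M : OMDP S A L) (adv : M.Adversary) (ε c : ℝ) (br : ℕ → S → A)
    (E : ℕ → S → Finset A) (w : ℕ → ℕ) (π : ℕ → Policy S A) : Prop where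
  start : w 0 = 0
  /-- The oracle answers the average loss of the rounds `w t, …, t - 1` of the window. -/
  oracle : ∀ t, M.IsEpsBestResponse ε
    (((t - w t : ℕ) : ℝ)⁻¹ • ∑ i ∈ Finset.Ico (w t) t, adv.loss π i) (br t)
  /-- If all actions of the response are effective, the window goes on. -/
  keep : ∀ t, (∀ s, br t s ∈ E t s) → E (t + 1) = E t ∧ w (t + 1) = w t
  /-- Otherwise a new window starts, ... -/
  reset : ∀ t, (∃ s, br t s ∉ E t s) → w (t + 1) = t
  /-- ... the action of the response becomes effective where it was not yet, ... -/
  add_new : ∀ t s, br t s ∉ E t s → E (t + 1) s = insert (br t s) (E t s)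
  /-- ... and in the other states some action (if any is left) is added. -/
  add_other : ∀ t s, (∃ s', br t s' ∉ E t s') → br t s ∈ E t s →
    (∃ a, a ∉ E t s ∧ E (t + 1) s = insert a (E t s)) ∨
      (E t s = Finset.univ ∧ E (t + 1) s = Finset.univ)
  /-- In every state the agent follows multiplicative weights over the effective actions, with
  the accumulated losses in the current window as feedback. -/
  play : ∀ t s a, (π t s : A → ℝ) a =
    mwu (E (t + 1) s)
      (c * √(Real.log (E (t + 1) s).card / ((t - w (t + 1) + 1 : ℕ) : ℝ)))
      (fun a' => ∑ i ∈ Finset.Ico (w (t + 1)) t, M.accLoss (π i) (adv.loss π i) s a') a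

end

/-! Every reset strictly enlarges an effective set and the sets are finite, so there is a last
window (`exists_last_window`), in which every oracle answer is effective. There the performance
difference lemma (`statDist_sub_statDist`) writes the regret against a deterministic policy as an
average, over that policy's stationary states, of the multiplicative weights regrets with feedback
`accLoss`; these are sublinear (`mwu_eventually_regret_le`). The current oracle answer is such a
competitor and is within `ε` of every policy on the window average, while the rounds before the
window cost only a constant. This gives `ε`-regret for stationary laws.

Multiplicative weights also change slowly (`tendsto_mwu_sub`), and a mixing chain driven by slowly
changing policies stays close to the current stationary law, so actual and stationary losses differ
by `o(T)` (`drift`).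

Adding the regrets of the two players bounds the duality gap of the average strategies
(`isEpsNash_average`); compactness turns approximate equilibria into proximity to `ε`-equilibria.
For policy regret, an adversary that faces `π₀` forever has no regret against the fixed loss
`avgLoss` of the real play, so `π₀` does not fare essentially better there than against the observed
losses (`policyRegret_le`). -/

namespace OMDP

variable {S A : Type*} [Fintype S] [Fintype A] {L : ℕ} {M : OMDP S A L}

/-! ### Mixing chains, stationary laws, and slowly changing policies. -/

lemma transMat_nonneg (π : Policy S A) (s s' : S) : 0 ≤ M.transMat π s s' :=
  Finset.sum_nonneg fun a _ => mul_nonneg ((π s).2.1 a) ((M.P s a).2.1 s')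

lemma transMat_sum (π : Policy S A) (s : S) : ∑ s', M.transMat π s s' = 1 := by
  unfold transMat
  rw [Finset.sum_comm]
  simp only [← Finset.mul_sum]
  have h : ∀ a, ∑ s', M.P s a s' = 1 := fun a => (M.P s a).2.2
  simp only [h, mul_one]
  exact (π s).2.2

lemma vecMul_transMat_mem {ρ : S → ℝ} (hρ : ρ ∈ stdSimplex ℝ S) (π : Policy S A) :
    ρ ᵥ* M.transMat π ∈ stdSimplex ℝ S := by
  constructor
  · intro s'
    exact Finset.sum_nonneg fun s _ => mul_nonneg (hρ.1 s) (transMat_nonneg π s s')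
  · simp only [Matrix.vecMul, dotProduct]
    rw [Finset.sum_comm]
    simp only [← Finset.mul_sum, transMat_sum, mul_one]
    exact hρ.2

lemma stateLaw_mem {ρ : S → ℝ} (hρ : ρ ∈ stdSimplex ℝ S) (π : ℕ → Policy S A) (t : ℕ) :
    M.stateLaw ρ π t ∈ stdSimplex ℝ S := by
  induction t with
  | zero => exact hρ
  | succ t ih => exact vecMul_transMat_mem ih (π t)

lemma Mixing.contract {τ : ℝ} (h : M.Mixing τ) (π : Policy S A) {ρ ρ' : S → ℝ}
    (hρ : ρ ∈ stdSimplex ℝ S) (hρ' : ρ' ∈ stdSimplex ℝ S) :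
    ∑ s, |(ρ ᵥ* M.transMat π) s - (ρ' ᵥ* M.transMat π) s|
      ≤ Real.exp (-1 / τ) * ∑ s, |ρ s - ρ' s| :=
  h π ⟨ρ, hρ⟩ ⟨ρ', hρ'⟩

lemma exp_rate_lt_one {τ : ℝ} (hτ : 0 < τ) : Real.exp (-1 / τ) < 1 := by
  rw [Real.exp_lt_one_iff]
  exact div_neg_of_neg_of_pos (by norm_num) hτ

lemma sum_abs_sub_le_two {ι : Type*} [Fintype ι] {ρ ρ' : ι → ℝ} (hρ : ρ ∈ stdSimplex ℝ ι)
    (hρ' : ρ' ∈ stdSimplex ℝ ι) : ∑ s, |ρ s - ρ' s| ≤ 2 := by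
  calc ∑ s, |ρ s - ρ' s| ≤ ∑ s, (ρ s + ρ' s) := by
        refine Finset.sum_le_sum fun s _ => abs_le.2 ⟨?_, ?_⟩ <;>
          linarith [hρ.1 s, hρ'.1 s]
    _ = 2 := by rw [Finset.sum_add_distrib, hρ.2, hρ'.2]; norm_num

/-- Two chains driven by the same fixed policy merge at a geometric rate. -/
lemma Mixing.stateLaw_sub {τ : ℝ} (h : M.Mixing τ) (π : Policy S A) {ρ ρ' : S → ℝ}
    (hρ : ρ ∈ stdSimplex ℝ S) (hρ' : ρ' ∈ stdSimplex ℝ S) (t : ℕ) :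
    ∑ s, |M.stateLaw ρ (fun _ => π) t s - M.stateLaw ρ' (fun _ => π) t s|
      ≤ 2 * Real.exp (-1 / τ) ^ t := by
  induction t with
  | zero =>
    rw [pow_zero, mul_one]
    exact sum_abs_sub_le_two hρ hρ'
  | succ t ih =>
    calc _ ≤ Real.exp (-1 / τ) *
          ∑ s, |M.stateLaw ρ (fun _ => π) t s - M.stateLaw ρ' (fun _ => π) t s| :=
          h.contract π (stateLaw_mem hρ _ t) (stateLaw_mem hρ' _ t)
      _ ≤ Real.exp (-1 / τ) * (2 * Real.exp (-1 / τ) ^ t) := by gcongr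
      _ = _ := by ring

lemma stateLaw_const_succ (ρ : S → ℝ) (π : Policy S A) (t : ℕ) :
    M.stateLaw ρ (fun _ => π) (t + 1)
      = M.stateLaw (ρ ᵥ* M.transMat π) (fun _ => π) t := by
  induction t with
  | zero => rfl
  | succ t ih => rw [stateLaw, ih, stateLaw]

/-- Consecutive iterates are the `n`-step laws from two different starting laws, so they are
geometrically close. The iterates thus converge, and the limit is fixed by continuity. -/
lemma Mixing.exists_stationary {τ : ℝ} (hτ : 0 < τ) (h : M.Mixing τ) (π : Policy S A) :
    ∃ ρ ∈ stdSimplex ℝ S, ρ ᵥ* M.transMat π = ρ := by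
  set u : ℕ → S → ℝ := M.stateLaw M.init (fun _ => π) with hu
  have hmem : ∀ n, u n ∈ stdSimplex ℝ S := stateLaw_mem M.init.2 _
  have hd : ∀ n, dist (u n) (u (n + 1)) ≤ 2 * Real.exp (-1 / τ) ^ n := by
    intro n
    rw [dist_pi_le_iff (by positivity)]
    intro s
    rw [Real.dist_eq, hu, stateLaw_const_succ]
    refine le_trans ?_ (h.stateLaw_sub π M.init.2
      (vecMul_transMat_mem (M := M) M.init.2 π) n)
    exact Finset.single_le_sum (f := fun s => |M.stateLaw M.init (fun _ => π) n s -
      M.stateLaw ((M.init : S → ℝ) ᵥ* M.transMat π) (fun _ => π) n s|)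
      (fun _ _ => abs_nonneg _) (Finset.mem_univ s)
  obtain ⟨ρ, hρ⟩ := cauchySeq_tendsto_of_complete
    (cauchySeq_of_le_geometric _ _ (exp_rate_lt_one hτ) hd)
  refine ⟨ρ, (isClosed_stdSimplex ℝ S).mem_of_tendsto hρ (Eventually.of_forall hmem), ?_⟩
  have h1 : Tendsto (fun n => u (n + 1)) atTop (𝓝 ρ) := (tendsto_add_atTop_iff_nat 1).2 hρ
  have hc : Continuous fun v : S → ℝ => v ᵥ* M.transMat π := by fun_prop
  exact tendsto_nhds_unique ((hc.tendsto ρ).comp hρ) h1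

lemma statState_mem {τ : ℝ} (hτ : 0 < τ) (h : M.Mixing τ) (π : Policy S A) :
    M.statState π ∈ stdSimplex ℝ S := by
  rw [statState, dif_pos (h.exists_stationary hτ π)]
  exact (h.exists_stationary hτ π).choose_spec.1

lemma statState_fixed {τ : ℝ} (hτ : 0 < τ) (h : M.Mixing τ) (π : Policy S A) :
    M.statState π ᵥ* M.transMat π = M.statState π := by
  rw [statState, dif_pos (h.exists_stationary hτ π)]
  exact (h.exists_stationary hτ π).choose_spec.2

lemma stateLaw_statState {τ : ℝ} (hτ : 0 < τ) (h : M.Mixing τ) (π : Policy S A) (t : ℕ) :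
    M.stateLaw (M.statState π) (fun _ => π) t = M.statState π := by
  induction t with
  | zero => rfl
  | succ t ih => rw [stateLaw, ih, statState_fixed hτ h]

lemma stateLaw_sub_statState {τ : ℝ} (hτ : 0 < τ) (h : M.Mixing τ) (π : Policy S A)
    {ρ : S → ℝ} (hρ : ρ ∈ stdSimplex ℝ S) (t : ℕ) :
    ∑ s, |M.stateLaw ρ (fun _ => π) t s - M.statState π s| ≤ 2 * Real.exp (-1 / τ) ^ t := by
  have := h.stateLaw_sub π hρ (statState_mem hτ h π) t
  rwa [stateLaw_statState hτ h] at this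

lemma vecMul_transMat_sub_le {ρ : S → ℝ} (hρ : ρ ∈ stdSimplex ℝ S) (π π' : Policy S A) :
    ∑ s, |(ρ ᵥ* M.transMat π) s - (ρ ᵥ* M.transMat π') s|
      ≤ ∑ s, ∑ a, |π s a - π' s a| := by
  have h1 : ∀ s', (ρ ᵥ* M.transMat π) s' - (ρ ᵥ* M.transMat π') s'
      = ∑ s, ∑ a, ρ s * ((π s a - π' s a) * M.P s a s') := by
    intro s'
    simp only [Matrix.vecMul, dotProduct, transMat, ← Finset.sum_sub_distrib, Finset.mul_sum]
    refine Finset.sum_congr rfl fun s _ => Finset.sum_congr rfl fun a _ => by ring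
  calc _ ≤ ∑ s', ∑ s, ∑ a, |π s a - π' s a| * M.P s a s' := by
        refine Finset.sum_le_sum fun s' _ => ?_
        rw [h1]
        refine (Finset.abs_sum_le_sum_abs _ _).trans (Finset.sum_le_sum fun s _ => ?_)
        refine (Finset.abs_sum_le_sum_abs _ _).trans (Finset.sum_le_sum fun a _ => ?_)
        have h0 : |M.P s a s'| = M.P s a s' := abs_of_nonneg ((M.P s a).2.1 s')
        rw [abs_mul, abs_mul, abs_of_nonneg (hρ.1 s), h0]
        have h2 : ρ s ≤ 1 := (mem_Icc_of_mem_stdSimplex hρ s).2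
        exact mul_le_of_le_one_left (mul_nonneg (abs_nonneg _) ((M.P s a).2.1 s')) h2
    _ = ∑ s, ∑ a, |π s a - π' s a| := by
        rw [Finset.sum_comm]
        refine Finset.sum_congr rfl fun s _ => ?_
        rw [Finset.sum_comm]
        refine Finset.sum_congr rfl fun a _ => ?_
        have h3 : ∑ s', M.P s a s' = 1 := (M.P s a).2.2
        rw [← Finset.mul_sum, h3, mul_one]

/-- The stationary law depends on the policy in a Lipschitz way. -/
lemma statState_sub_le {τ : ℝ} (hτ : 0 < τ) (h : M.Mixing τ) (π π' : Policy S A) :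
    (1 - Real.exp (-1 / τ)) * ∑ s, |M.statState π s - M.statState π' s|
      ≤ ∑ s, ∑ a, |π s a - π' s a| := by
  have h1 := h.contract π (statState_mem hτ h π) (statState_mem hτ h π')
  have h2 := vecMul_transMat_sub_le (M := M) (statState_mem hτ h π') π π'
  rw [statState_fixed hτ h π] at h1
  rw [statState_fixed hτ h π'] at h2
  -- Going through one `π`-step from the stationary law of `π'`: the first distance is contracted,
  -- the second is a one-step perturbation.
  have h3 : ∑ s, |M.statState π s - M.statState π' s|
      ≤ ∑ s, |M.statState π s - (M.statState π' ᵥ* M.transMat π) s|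
        + ∑ s, |(M.statState π' ᵥ* M.transMat π) s - M.statState π' s| := by
    rw [← Finset.sum_add_distrib]
    exact Finset.sum_le_sum fun s _ => abs_sub_le _ _ _
  linarith

lemma tendsto_zero_of_le_mul_add {q : ℝ} (hq0 : 0 ≤ q) (hq1 : q < 1) {x y : ℕ → ℝ}
    (hx : ∀ n, 0 ≤ x n) (hxy : ∀ n, x (n + 1) ≤ q * x n + y n)
    (hy : Tendsto y atTop (𝓝 0)) : Tendsto x atTop (𝓝 0) := by
  rw [Metric.tendsto_atTop]
  intro r hr
  -- Below this level of `y`, the bound `r / 2` reproduces itself under `x ↦ q * x + y`.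
  have hp : 0 < (1 - q) * (r / 2) := by nlinarith
  obtain ⟨N, hN⟩ := eventually_atTop.1 (hy.eventually_lt_const hp)
  have key : ∀ n, x (N + n) ≤ q ^ n * x N + r / 2 := by
    intro n
    induction n with
    | zero => simp; linarith
    | succ n ih =>
      have h1 := hxy (N + n)
      have h2 := hN (N + n) (by omega)
      have h3 := mul_le_mul_of_nonneg_left ih hq0
      rw [← add_assoc, pow_succ]
      nlinarith
  have h4 : Tendsto (fun n => q ^ n * x N) atTop (𝓝 0) := by
    simpa using (tendsto_pow_atTop_nhds_zero_of_lt_one hq0 hq1).mul_const (x N)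
  obtain ⟨K, hK⟩ := eventually_atTop.1 (h4.eventually_lt_const (half_pos hr))
  refine ⟨N + K, fun n hn => ?_⟩
  obtain ⟨m, rfl⟩ := Nat.exists_eq_add_of_le (show N ≤ n by omega)
  rw [Real.dist_eq, sub_zero, abs_of_nonneg (hx _)]
  linarith [key m, hK m (by omega)]

/-- If the policies change slowly, the state law follows the stationary law. -/
lemma tendsto_stateLaw_sub_statState {τ : ℝ} (hτ : 0 < τ) (h : M.Mixing τ)
    {π : ℕ → Policy S A}
    (hπ : Tendsto (fun t => ∑ s, ∑ a, |π t s a - π (t + 1) s a|) atTop (𝓝 0)) :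
    Tendsto (fun t => ∑ s, |M.stateLaw M.init π t s - M.statState (π t) s|) atTop (𝓝 0) := by
  have hq : 0 < 1 - Real.exp (-1 / τ) := sub_pos.2 (exp_rate_lt_one hτ)
  have hy := hπ.const_mul (1 - Real.exp (-1 / τ))⁻¹
  rw [mul_zero] at hy
  refine tendsto_zero_of_le_mul_add (Real.exp_pos _).le (exp_rate_lt_one hτ)
    (fun n => Finset.sum_nonneg fun _ _ => abs_nonneg _) (fun t => ?_) hy
  have h1 := h.contract (π t) (stateLaw_mem (M := M) M.init.2 π t)
    (statState_mem hτ h (π t))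
  rw [statState_fixed hτ h] at h1
  have h2 := statState_sub_le hτ h (π t) (π (t + 1))
  rw [← le_div_iff₀' hq, div_eq_inv_mul] at h2
  -- The law first contracts towards the old stationary law, which then moves by a multiple of the
  -- policy change.
  have h3 : ∑ s, |M.stateLaw M.init π (t + 1) s - M.statState (π (t + 1)) s|
      ≤ ∑ s, |M.stateLaw M.init π (t + 1) s - M.statState (π t) s|
        + ∑ s, |M.statState (π t) s - M.statState (π (t + 1)) s| := by
    rw [← Finset.sum_add_distrib]
    exact Finset.sum_le_sum fun s _ => abs_sub_le _ _ _
  exact h3.trans (add_le_add h1 h2)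

lemma jointLaw_mem {ρ : S → ℝ} (hρ : ρ ∈ stdSimplex ℝ S) (π : Policy S A) :
    jointLaw ρ π ∈ stdSimplex ℝ (S × A) := by
  constructor
  · exact fun x => mul_nonneg (hρ.1 _) ((π x.1).2.1 x.2)
  · have h : ∀ s, ∑ a, π s a = 1 := fun s => (π s).2.2
    simp only [jointLaw, Fintype.sum_prod_type, ← Finset.mul_sum, h, mul_one]
    exact hρ.2

lemma sum_abs_jointLaw_sub (ρ ρ' : S → ℝ) (π : Policy S A) :
    ∑ x, |jointLaw ρ π x - jointLaw ρ' π x| = ∑ s, |ρ s - ρ' s| := by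
  have h : ∀ s, ∑ a, π s a = 1 := fun s => (π s).2.2
  have h' : ∀ s a, |π s a| = π s a := fun s a => abs_of_nonneg ((π s).2.1 a)
  simp only [jointLaw, Fintype.sum_prod_type, ← sub_mul, abs_mul, h', ← Finset.mul_sum, h,
    mul_one]

lemma abs_dotProduct_sub_le {ι : Type*} [Fintype ι] {l : ι → ℝ} {B : ℝ}
    (hl : ∀ i, |l i| ≤ B) (v v' : ι → ℝ) : |l ⬝ᵥ v - l ⬝ᵥ v'| ≤ B * ∑ i, |v i - v' i| := by
  rw [← dotProduct_sub, dotProduct, Finset.mul_sum]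
  refine (Finset.abs_sum_le_sum_abs _ _).trans (Finset.sum_le_sum fun i _ => ?_)
  rw [abs_mul]
  exact mul_le_mul_of_nonneg_right (hl i) (abs_nonneg _)

lemma statDist_mem {τ : ℝ} (hτ : 0 < τ) (h : M.Mixing τ) (π : Policy S A) :
    M.statDist π ∈ stdSimplex ℝ (S × A) :=
  jointLaw_mem (statState_mem hτ h π) π

lemma lossSimplex_mem_Icc {l : S × A → ℝ} (hl : l ∈ M.lossSimplex) (x : S × A) :
    l x ∈ Set.Icc (0 : ℝ) 1 := by
  have h : M.lossSimplex ⊆ Set.Icc 0 1 := by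
    refine convexHull_min ?_ (convex_Icc _ _)
    rintro _ ⟨i, rfl⟩
    exact ⟨fun x => (M.lossVec_mem i x).1, fun x => (M.lossVec_mem i x).2⟩
  exact ⟨(h hl).1 x, (h hl).2 x⟩

lemma lossSimplex_abs_le {l : S × A → ℝ} (hl : l ∈ M.lossSimplex) (x : S × A) : |l x| ≤ 1 :=
  abs_le.2 ⟨by linarith [(lossSimplex_mem_Icc hl x).1], (lossSimplex_mem_Icc hl x).2⟩

lemma dotProduct_mem_Icc {ι : Type*} [Fintype ι] {l v : ι → ℝ} (hl : ∀ i, l i ∈ Set.Icc (0 : ℝ) 1)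
    (hv : v ∈ stdSimplex ℝ ι) : l ⬝ᵥ v ∈ Set.Icc (0 : ℝ) 1 := by
  refine ⟨Finset.sum_nonneg fun i _ => mul_nonneg (hl i).1 (hv.1 i), ?_⟩
  rw [← hv.2]
  exact Finset.sum_le_sum fun i _ => mul_le_of_le_one_left (hv.1 i) (hl i).2

end OMDP

/-! ### Excess losses, the Bellman equation and performance differences. -/

namespace OMDP

variable {S A : Type*} [Fintype A]

lemma jointLaw_sum {ι : Type*} [Fintype ι] (c : ι → ℝ) (ρ : ι → S → ℝ) (π : Policy S A) :
    jointLaw (∑ i, c i • ρ i) π = ∑ i, c i • jointLaw (ρ i) π := by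
  ext x
  simp only [jointLaw, Finset.sum_apply, Pi.smul_apply, smul_eq_mul, Finset.sum_mul, mul_assoc]

lemma detPolicy_sum (b : S → A) (s : S) (f : A → ℝ) :
    ∑ a, detPolicy b s a * f a = f (b s) := by
  classical
  have h : ∀ a, detPolicy b s a = if a = b s then (1 : ℝ) else 0 := fun a => by
    simp only [detPolicy]
    change (Pi.single (b s) (1 : ℝ) : A → ℝ) a = _
    rw [Pi.single_apply]
  simp [h]

variable [Fintype S] {L : ℕ} {M : OMDP S A L}

lemma stateLaw_sum {ι : Type*} [Fintype ι] (c : ι → ℝ) (ρ : ι → S → ℝ) (π : ℕ → Policy S A)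
    (n : ℕ) : M.stateLaw (∑ i, c i • ρ i) π n = ∑ i, c i • M.stateLaw (ρ i) π n := by
  induction n with
  | zero => rfl
  | succ n ih => simp only [stateLaw, ih, Matrix.sum_vecMul, Matrix.smul_vecMul]

variable (M) in
/-- The expected loss of round `n` in excess of the stationary loss, when the first state has
law `ρ` and `π` is followed. -/
noncomputable def excess (π : Policy S A) (l : S × A → ℝ) (ρ : S → ℝ) (n : ℕ) : ℝ :=
  l ⬝ᵥ jointLaw (M.stateLaw ρ (fun _ => π) n) π - l ⬝ᵥ M.statDist π

variable (M) in
/-- The total excess loss of `π` when the first state has law `ρ`. -/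
noncomputable def bias (π : Policy S A) (l : S × A → ℝ) (ρ : S → ℝ) : ℝ := ∑' n, M.excess π l ρ n

lemma abs_excess_le {τ : ℝ} (hτ : 0 < τ) (h : M.Mixing τ) (π : Policy S A) {l : S × A → ℝ}
    {B : ℝ} (hl : ∀ x, |l x| ≤ B) (hB : 0 ≤ B) {ρ : S → ℝ} (hρ : ρ ∈ stdSimplex ℝ S) (n : ℕ) :
    |M.excess π l ρ n| ≤ B * 2 * Real.exp (-1 / τ) ^ n := by
  refine (abs_dotProduct_sub_le hl _ _).trans ?_
  rw [statDist, sum_abs_jointLaw_sub, mul_assoc]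
  exact mul_le_mul_of_nonneg_left (stateLaw_sub_statState hτ h π hρ n) hB

lemma summable_geometric_bound {τ : ℝ} (hτ : 0 < τ) (B : ℝ) :
    Summable fun n : ℕ => B * Real.exp (-1 / τ) ^ n :=
  (summable_geometric_of_lt_one (Real.exp_pos _).le (exp_rate_lt_one hτ)).mul_left _

/-- The loss is arbitrary here because the separation argument in `statDist_mem_statSimplex`
produces losses outside `[0,1]`. -/
lemma summable_excess {τ : ℝ} (hτ : 0 < τ) (h : M.Mixing τ) (π : Policy S A) (l : S × A → ℝ)
    {ρ : S → ℝ} (hρ : ρ ∈ stdSimplex ℝ S) : Summable (M.excess π l ρ) := by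
  have hl : ∀ x, |l x| ≤ ‖l‖ := fun x => norm_le_pi_norm l x
  exact Summable.of_norm_bounded (summable_geometric_bound hτ (‖l‖ * 2))
    fun n => abs_excess_le hτ h π hl (norm_nonneg l) hρ n

lemma abs_bias_le {τ : ℝ} (hτ : 0 < τ) (h : M.Mixing τ) (π : Policy S A) {l : S × A → ℝ}
    (hl : ∀ x, |l x| ≤ 1) {ρ : S → ℝ} (hρ : ρ ∈ stdSimplex ℝ S) :
    |M.bias π l ρ| ≤ 2 * (1 - Real.exp (-1 / τ))⁻¹ := by
  have hs := summable_geometric_bound hτ (1 * 2)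
  have h1 : ‖∑' n, M.excess π l ρ n‖ ≤ _ := tsum_of_norm_bounded hs.hasSum
    fun n => abs_excess_le hτ h π hl zero_le_one hρ n
  rwa [tsum_mul_left, tsum_geometric_of_lt_one (Real.exp_pos _).le (exp_rate_lt_one hτ),
    one_mul] at h1

/-- The subtracted stationary loss makes the excess affine rather than linear in the initial law, so
the weights must sum to one. -/
lemma excess_sum {ι : Type*} [Fintype ι] (π : Policy S A) (l : S × A → ℝ) {c : ι → ℝ}
    (hc : c ∈ stdSimplex ℝ ι) (ρ : ι → S → ℝ) (n : ℕ) :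
    M.excess π l (∑ i, c i • ρ i) n = ∑ i, c i * M.excess π l (ρ i) n := by
  simp only [excess, stateLaw_sum, jointLaw_sum, dotProduct_sum, dotProduct_smul, smul_eq_mul,
    mul_sub, Finset.sum_sub_distrib, ← Finset.sum_mul, hc.2, one_mul]

lemma bias_sum {τ : ℝ} (hτ : 0 < τ) (h : M.Mixing τ) {ι : Type*} [Fintype ι] (π : Policy S A)
    (l : S × A → ℝ) {c : ι → ℝ} (hc : c ∈ stdSimplex ℝ ι) {ρ : ι → S → ℝ}
    (hρ : ∀ i, ρ i ∈ stdSimplex ℝ S) :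
    M.bias π l (∑ i, c i • ρ i) = ∑ i, c i * M.bias π l (ρ i) := by
  simp only [bias, excess_sum π l hc]
  rw [Summable.tsum_finsetSum fun i _ => (summable_excess hτ h π l (hρ i)).mul_left _]
  simp only [tsum_mul_left]

lemma bias_eq_add {τ : ℝ} (hτ : 0 < τ) (h : M.Mixing τ) (π : Policy S A) (l : S × A → ℝ)
    {ρ : S → ℝ} (hρ : ρ ∈ stdSimplex ℝ S) :
    M.bias π l ρ = (l ⬝ᵥ jointLaw ρ π - l ⬝ᵥ M.statDist π)
      + M.bias π l (ρ ᵥ* M.transMat π) := by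
  rw [bias, (summable_excess hτ h π l hρ).tsum_eq_zero_add]
  simp only [excess, stateLaw_const_succ, bias]
  rfl

lemma accLoss_eq (π : Policy S A) (l : S × A → ℝ) (s : S) (a : A) :
    M.accLoss π l s a = (l (s, a) - l ⬝ᵥ M.statDist π) + M.bias π l (M.P s a) := rfl

lemma vecMul_transMat_eq_sum (ρ : S → ℝ) (π : Policy S A) :
    ρ ᵥ* M.transMat π = ∑ x : S × A, jointLaw ρ π x • (M.P x.1 x.2 : S → ℝ) := by
  ext s'
  simp only [Matrix.vecMul, dotProduct, transMat, Fintype.sum_prod_type, Finset.sum_apply,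
    Pi.smul_apply, smul_eq_mul, jointLaw, Finset.mul_sum, mul_assoc]

/-- Bellman equation. -/
lemma sum_jointLaw_mul_accLoss {τ : ℝ} (hτ : 0 < τ) (h : M.Mixing τ) (π π' : Policy S A)
    (l : S × A → ℝ) {ρ : S → ℝ} (hρ : ρ ∈ stdSimplex ℝ S) :
    ∑ x : S × A, jointLaw ρ π' x * M.accLoss π l x.1 x.2
      = (l ⬝ᵥ jointLaw ρ π' - l ⬝ᵥ M.statDist π) + M.bias π l (ρ ᵥ* M.transMat π') := by
  have hj := jointLaw_mem hρ π'
  have hb := bias_sum hτ h π l hj fun x => (M.P x.1 x.2).2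
  rw [vecMul_transMat_eq_sum]
  refine Eq.trans ?_ (congrArg (_ + ·) hb.symm)
  simp only [accLoss_eq, mul_add, mul_sub, Finset.sum_add_distrib, Finset.sum_sub_distrib,
    ← Finset.sum_mul, hj.2, one_mul]
  congr 2
  rw [dotProduct_comm]
  rfl

lemma bias_eq_sum {τ : ℝ} (hτ : 0 < τ) (h : M.Mixing τ) (π : Policy S A) (l : S × A → ℝ)
    {ρ : S → ℝ} (hρ : ρ ∈ stdSimplex ℝ S) :
    M.bias π l ρ = ∑ x : S × A, jointLaw ρ π x * M.accLoss π l x.1 x.2 := by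
  rw [sum_jointLaw_mul_accLoss hτ h π π l hρ, bias_eq_add hτ h π l hρ]

/-- Performance difference lemma. -/
lemma statDist_sub_statDist {τ : ℝ} (hτ : 0 < τ) (h : M.Mixing τ) (π π' : Policy S A)
    (l : S × A → ℝ) :
    l ⬝ᵥ M.statDist π' - l ⬝ᵥ M.statDist π = ∑ s, M.statState π' s *
      (∑ a, π' s a * M.accLoss π l s a - ∑ a, π s a * M.accLoss π l s a) := by
  have hm := statState_mem hτ h π'
  have h1 := sum_jointLaw_mul_accLoss hτ h π π' l hm
  -- At the stationary law of `π'` a further `π'`-step changes nothing, so the remaining bias is the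
  -- average of `accLoss` over the actions of `π`.
  rw [statState_fixed hτ h, bias_eq_sum hτ h π l hm] at h1
  simp only [jointLaw, Fintype.sum_prod_type, mul_assoc, ← Finset.mul_sum] at h1
  simp only [mul_sub, Finset.sum_sub_distrib]
  rw [h1]
  simp only [statDist]
  ring

lemma abs_accLoss_le {τ : ℝ} (hτ : 0 < τ) (h : M.Mixing τ) (π : Policy S A) {l : S × A → ℝ}
    (hl : l ∈ M.lossSimplex) (s : S) (a : A) :
    |M.accLoss π l s a| ≤ 1 + 2 * (1 - Real.exp (-1 / τ))⁻¹ := by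
  rw [accLoss_eq]
  refine (abs_add_le _ _).trans (add_le_add ?_
    (abs_bias_le hτ h π (lossSimplex_abs_le hl) (M.P s a).2))
  have h1 := lossSimplex_mem_Icc hl (s, a)
  have h2 := dotProduct_mem_Icc (lossSimplex_mem_Icc hl) (statDist_mem hτ h π)
  exact abs_le.2 ⟨by linarith [h1.1, h2.2], by linarith [h1.2, h2.1]⟩

lemma statSimplex_isCompact : IsCompact M.statSimplex :=
  (Set.finite_range _).isCompact_convexHull ℝ

lemma lossSimplex_isCompact : IsCompact M.lossSimplex :=
  (Set.finite_range _).isCompact_convexHull ℝ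

/-- For every linear loss, some deterministic policy does at least as well as `π`. -/
lemma exists_detPolicy_le [Nonempty A] {τ : ℝ} (hτ : 0 < τ) (h : M.Mixing τ) (π : Policy S A)
    (l : S × A → ℝ) : ∃ b, l ⬝ᵥ M.statDist (detPolicy b) ≤ l ⬝ᵥ M.statDist π := by
  -- Policy improvement: act greedily for the accumulated loss of `π`.
  choose b hb using fun s => Finite.exists_min (M.accLoss π l s)
  refine ⟨b, ?_⟩
  rw [← sub_nonpos, statDist_sub_statDist hτ h π]
  refine Finset.sum_nonpos fun s _ =>
    mul_nonpos_of_nonneg_of_nonpos ((statState_mem hτ h _).1 s) ?_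
  rw [detPolicy_sum, sub_nonpos]
  have h1 : ∑ a, π s a = 1 := (π s).2.2
  calc M.accLoss π l s (b s) = ∑ a, π s a * M.accLoss π l s (b s) := by
        rw [← Finset.sum_mul, h1, one_mul]
    _ ≤ _ := Finset.sum_le_sum fun a _ => mul_le_mul_of_nonneg_left (hb s a) ((π s).2.1 a)

/-- A hyperplane separating the point from the hull would be a loss for which `π` beats every
deterministic policy, contrary to policy improvement. -/
lemma statDist_mem_statSimplex [Nonempty A] {τ : ℝ} (hτ : 0 < τ) (h : M.Mixing τ)
    (π : Policy S A) : M.statDist π ∈ M.statSimplex := by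
  classical
  by_contra hn
  obtain ⟨f, u, hu, hf⟩ := geometric_hahn_banach_point_closed (convex_convexHull ℝ _)
    (statSimplex_isCompact (M := M)).isClosed hn
  set l : S × A → ℝ := fun x => f (Pi.single x 1) with hl
  have hfl : ∀ v, f v = l ⬝ᵥ v := by
    intro v
    conv_lhs => rw [pi_eq_sum_univ' v]
    rw [map_sum, dotProduct]
    refine Finset.sum_congr rfl fun x _ => ?_
    rw [map_smul, smul_eq_mul, mul_comm, hl]
  obtain ⟨b, hb⟩ := exists_detPolicy_le hτ h π l
  rw [← hfl, ← hfl] at hb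
  linarith [hf _ (subset_convexHull ℝ _ (Set.mem_range_self b))]

end OMDP

/-! ### Multiplicative weights: sublinear regret and slow change. -/

section MultiplicativeWeights

variable {A : Type*}

/-- The potential of multiplicative weights: the soft minimum of `K` over `B`. -/
noncomputable def softMin (B : Finset A) (η : ℝ) (K : A → ℝ) : ℝ :=
  -(Real.log ((∑ a ∈ B, Real.exp (-η * K a)) / B.card) / η)

lemma sum_exp_pos {B : Finset A} (hB : B.Nonempty) (η : ℝ) (K : A → ℝ) :
    0 < ∑ a ∈ B, Real.exp (-η * K a) :=
  Finset.sum_pos (fun _ _ => Real.exp_pos _) hB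

lemma softMin_zero {B : Finset A} (hB : B.Nonempty) (η : ℝ) :
    softMin B η (fun _ => 0) = 0 := by
  have : (B.card : ℝ) ≠ 0 := by exact_mod_cast hB.card_pos.ne'
  simp [softMin, this]

lemma softMin_le {B : Finset A} {η : ℝ} (hη : 0 < η) (K : A → ℝ) {a : A} (ha : a ∈ B) :
    softMin B η K ≤ K a + Real.log B.card / η := by
  have hk : (0 : ℝ) < B.card := by exact_mod_cast (Finset.card_pos.2 ⟨a, ha⟩)
  have h1 : Real.exp (-η * K a) ≤ ∑ b ∈ B, Real.exp (-η * K b) :=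
    Finset.single_le_sum (f := fun b => Real.exp (-η * K b)) (fun _ _ => (Real.exp_pos _).le) ha
  have h2 : -η * K a - Real.log B.card
      ≤ Real.log ((∑ b ∈ B, Real.exp (-η * K b)) / B.card) := by
    rw [Real.log_div (sum_exp_pos ⟨a, ha⟩ η K).ne' hk.ne']
    have := Real.log_le_log (Real.exp_pos _) h1
    rw [Real.log_exp] at this
    linarith
  have h3 := div_le_div_of_nonneg_right h2 hη.le
  have h4 : (-η * K a - Real.log B.card) / η = -(K a + Real.log B.card / η) := by
    field_simp
    ring
  rw [softMin]
  linarith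

/-- Power mean inequality with exponent `η / η' ≥ 1`. It makes lowering the learning rate free in
the potential argument. -/
lemma softMin_antitone {B : Finset A} (hB : B.Nonempty) {η η' : ℝ} (hη' : 0 < η') (h : η' ≤ η)
    (K : A → ℝ) : softMin B η K ≤ softMin B η' K := by
  have hk : (0 : ℝ) < B.card := by exact_mod_cast hB.card_pos
  have hη : 0 < η := hη'.trans_le h
  have h1 := Real.rpow_arith_mean_le_arith_mean_rpow B (fun _ => (B.card : ℝ)⁻¹)
    (fun a => Real.exp (-η' * K a)) (fun _ _ => (inv_pos.2 hk).le)
    (by rw [Finset.sum_const, nsmul_eq_mul, mul_inv_cancel₀ hk.ne'])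
    (fun _ _ => (Real.exp_pos _).le) ((one_le_div hη').2 h)
  have h2 : ∀ a, Real.exp (-η' * K a) ^ (η / η') = Real.exp (-η * K a) := by
    intro a
    rw [← Real.exp_mul]
    congr 1
    field_simp
  simp only [h2, inv_mul_eq_div, ← Finset.sum_div] at h1
  have h3 := Real.log_le_log (Real.rpow_pos_of_pos (div_pos (sum_exp_pos hB η' K) hk) _) h1
  rw [Real.log_rpow (div_pos (sum_exp_pos hB η' K) hk)] at h3
  rw [softMin, softMin, neg_le_neg_iff, le_div_iff₀ hη]
  refine le_trans (le_of_eq ?_) h3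
  ring

/-- Taylor's formula with a remainder valid for all `x`: feedback has either sign, and early
learning rates need not be small. -/
lemma exp_neg_le (x : ℝ) : Real.exp (-x) ≤ 1 - x + x ^ 2 * Real.exp |x| := by
  have h := Complex.norm_exp_sub_sum_le_norm_mul_exp ((-x : ℝ) : ℂ) 2
  simp only [Finset.sum_range_succ, Finset.sum_range_zero, ← Complex.ofReal_exp] at h
  norm_num at h
  have h1 : ((Real.exp (-x) : ℝ) : ℂ) - (1 + -(x : ℂ)) = ((Real.exp (-x) - (1 - x) : ℝ) : ℂ) := by
    push_cast
    ring
  rw [← Complex.ofReal_neg, ← Complex.ofReal_exp, Complex.ofReal_neg, h1, Complex.norm_real,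
    Real.norm_eq_abs] at h
  linarith [(abs_le.1 h).2]

variable [DecidableEq A]

lemma mwu_nonneg (B : Finset A) (η : ℝ) (K : A → ℝ) (a : A) : 0 ≤ mwu B η K a := by
  unfold mwu
  split_ifs
  · exact div_nonneg (Real.exp_pos _).le (Finset.sum_nonneg fun _ _ => (Real.exp_pos _).le)
  · exact le_rfl

lemma sum_mwu {B : Finset A} (hB : B.Nonempty) (η : ℝ) (K : A → ℝ) :
    ∑ a ∈ B, mwu B η K a = 1 := by
  have h : ∀ a ∈ B, mwu B η K a = Real.exp (-η * K a) / ∑ b ∈ B, Real.exp (-η * K b) :=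
    fun a ha => if_pos ha
  rw [Finset.sum_congr rfl h, ← Finset.sum_div]
  exact div_self (sum_exp_pos hB η K).ne'

/-- One round of multiplicative weights. -/
lemma sum_mwu_mul_le {B : Finset A} (hB : B.Nonempty) {η G : ℝ} (hη : 0 < η) (K q : A → ℝ)
    (hq : ∀ a, |q a| ≤ G) :
    ∑ a ∈ B, mwu B η K a * q a
      ≤ softMin B η (fun a => K a + q a) - softMin B η K + η * (G ^ 2 * Real.exp (η * G)) := by
  have hk : (0 : ℝ) < B.card := by exact_mod_cast hB.card_pos
  have hS := sum_exp_pos hB η K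
  have h1 : ∑ a ∈ B, Real.exp (-η * (K a + q a))
      -- The ratio of successive weight totals is the expectation of `exp (-η q)` under the current
      -- strategy.
      = (∑ a ∈ B, Real.exp (-η * K a)) * ∑ a ∈ B, mwu B η K a * Real.exp (-(η * q a)) := by
    rw [Finset.mul_sum]
    refine Finset.sum_congr rfl fun a ha => ?_
    rw [mwu, if_pos ha, mul_add, Real.exp_add, neg_mul η (q a)]
    field_simp
  have h2 : ∑ a ∈ B, mwu B η K a * Real.exp (-(η * q a))
      ≤ 1 - η * ∑ a ∈ B, mwu B η K a * q a + η * (η * (G ^ 2 * Real.exp (η * G))) := by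
    calc _ ≤ ∑ a ∈ B, mwu B η K a *
            (1 - η * q a + η * (η * (G ^ 2 * Real.exp (η * G)))) := by
          refine Finset.sum_le_sum fun a _ =>
            mul_le_mul_of_nonneg_left ((exp_neg_le _).trans ?_) (mwu_nonneg B η K a)
          have h3 : |η * q a| ≤ η * G := by
            rw [abs_mul, abs_of_pos hη]
            exact mul_le_mul_of_nonneg_left (hq a) hη.le
          have h4 : (η * q a) ^ 2 ≤ (η * G) ^ 2 := sq_le_sq' (abs_le.1 h3).1 (abs_le.1 h3).2
          have h5 := mul_le_mul h4 (Real.exp_le_exp.2 h3) (Real.exp_pos _).le (sq_nonneg _)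
          linarith
      _ = _ := by
          simp only [mul_add, mul_sub, Finset.sum_add_distrib, Finset.sum_sub_distrib,
            ← Finset.sum_mul, sum_mwu hB, mul_one, one_mul]
          rw [Finset.mul_sum]
          congr 2
          exact Finset.sum_congr rfl fun a _ => by ring
  have hP : 0 < ∑ a ∈ B, mwu B η K a * Real.exp (-(η * q a)) := by
    have := sum_exp_pos hB η fun a => K a + q a
    rw [h1] at this
    exact pos_of_mul_pos_right this hS.le
  have h6 : Real.log ((∑ a ∈ B, Real.exp (-η * (K a + q a))) / B.card)
      = Real.log ((∑ a ∈ B, Real.exp (-η * K a)) / B.card)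
        + Real.log (∑ a ∈ B, mwu B η K a * Real.exp (-(η * q a))) := by
    rw [h1, mul_div_right_comm, Real.log_mul (div_pos hS hk).ne' hP.ne']
  have h7 := Real.log_le_sub_one_of_pos hP
  have h8 : softMin B η (fun a => K a + q a) - softMin B η K
      = -(Real.log (∑ a ∈ B, mwu B η K a * Real.exp (-(η * q a))) / η) := by
    rw [softMin, softMin, h6]
    ring
  have h9 : Real.log (∑ a ∈ B, mwu B η K a * Real.exp (-(η * q a))) / η
      ≤ -(∑ a ∈ B, mwu B η K a * q a) + η * (G ^ 2 * Real.exp (η * G)) := by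
    rw [div_le_iff₀ hη]
    linarith
  linarith

/-- Regret of multiplicative weights with nonincreasing learning rates. -/
lemma mwu_regret_le {B : Finset A} {G : ℝ} (η : ℕ → ℝ) (hη : ∀ n, 0 < η n)
    (hanti : Antitone η) (g : ℕ → A → ℝ) (hg : ∀ n a, |g n a| ≤ G) {a : A} (ha : a ∈ B) (N : ℕ) :
    ∑ n ∈ Finset.range N,
        (∑ b ∈ B, mwu B (η n) (fun b => ∑ i ∈ Finset.range n, g i b) b * g n b - g n a)
      ≤ Real.log B.card / η N + (∑ n ∈ Finset.range N, η n) * (G ^ 2 * Real.exp (η 0 * G)) := by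
  have hB : B.Nonempty := ⟨a, ha⟩
  have hG : 0 ≤ G := (abs_nonneg _).trans (hg 0 a)
  have key : ∑ n ∈ Finset.range N,
        (∑ b ∈ B, mwu B (η n) (fun b => ∑ i ∈ Finset.range n, g i b) b * g n b)
      ≤ softMin B (η N) (fun b => ∑ i ∈ Finset.range N, g i b)
        + (∑ n ∈ Finset.range N, η n) * (G ^ 2 * Real.exp (η 0 * G)) := by
    induction N with
    | zero => simp [softMin_zero hB]
    | succ N ih =>
      rw [Finset.sum_range_succ, Finset.sum_range_succ (fun n => η n)]
      have h1 := sum_mwu_mul_le hB (hη N) (fun b => ∑ i ∈ Finset.range N, g i b) (g N) (hg N)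
      have h2 := softMin_antitone hB (hη (N + 1)) (hanti N.le_succ)
        (fun b => ∑ i ∈ Finset.range (N + 1), g i b)
      simp only [Finset.sum_range_succ (fun i => g i _)] at h2 ⊢
      have h3 : Real.exp (η N * G) ≤ Real.exp (η 0 * G) :=
        Real.exp_le_exp.2 (mul_le_mul_of_nonneg_right (hanti N.zero_le) hG)
      have h4 : η N * (G ^ 2 * Real.exp (η N * G)) ≤ η N * (G ^ 2 * Real.exp (η 0 * G)) :=
        mul_le_mul_of_nonneg_left (mul_le_mul_of_nonneg_left h3 (sq_nonneg _)) (hη N).le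
      linarith
  have h5 := softMin_le (hη N) (fun b => ∑ i ∈ Finset.range N, g i b) ha
  rw [Finset.sum_sub_distrib]
  linarith

lemma tendsto_learningRate (c x : ℝ) :
    Tendsto (fun n : ℕ => c * √(x / ((n + 1 : ℕ) : ℝ))) atTop (𝓝 0) := by
  have h1 : Tendsto (fun n : ℕ => x / ((n + 1 : ℕ) : ℝ)) atTop (𝓝 0) :=
    (tendsto_const_div_atTop_nhds_zero_nat x).comp (tendsto_add_atTop_nat 1)
  simpa using (Real.continuous_sqrt.tendsto 0 |>.comp h1).const_mul c

/-- Multiplicative weights with the learning rate `c * √(log k / n)` has sublinear regret. -/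
lemma mwu_eventually_regret_le {B : Finset A} {G c : ℝ} (hc : 0 < c) (g : ℕ → A → ℝ)
    (hg : ∀ n a, |g n a| ≤ G) {a : A} (ha : a ∈ B) {δ : ℝ} (hδ : 0 < δ) :
    ∀ᶠ N : ℕ in atTop, ∑ n ∈ Finset.range N,
        (∑ b ∈ B, mwu B (c * √(Real.log B.card / ((n + 1 : ℕ) : ℝ)))
          (fun b => ∑ i ∈ Finset.range n, g i b) b * g n b - g n a) ≤ δ * N := by
  have hcard : 1 ≤ B.card := Finset.card_pos.2 ⟨a, ha⟩
  -- With a single expert the learning rate is `0`, outside the scope of `mwu_regret_le`, but the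
  -- regret is zero.
  rcases hcard.eq_or_lt with h1 | h1
  · obtain ⟨b, rfl⟩ := Finset.card_eq_one.1 h1.symm
    obtain rfl := Finset.mem_singleton.1 ha
    refine Eventually.of_forall fun N => ?_
    have h2 : ∀ η K, mwu {a} η K a = 1 := fun η K => by
      have := sum_mwu (Finset.singleton_nonempty a) η K
      rwa [Finset.sum_singleton] at this
    simp only [Finset.sum_singleton, h2, one_mul, sub_self, Finset.sum_const_zero]
    positivity
  · have hlog : 0 < Real.log B.card := Real.log_pos (by exact_mod_cast h1)
    set x := Real.log B.card with hx
    set η : ℕ → ℝ := fun n => c * √(x / ((n + 1 : ℕ) : ℝ)) with hηdef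
    have hη : ∀ n, 0 < η n := fun n => by simp only [hηdef]; positivity
    have hanti : Antitone η := fun m n hmn => by simp only [hηdef]; gcongr
    have hlim : Tendsto η atTop (𝓝 0) := tendsto_learningRate c x
    have h2 := (hlim.cesaro.mul_const (G ^ 2 * Real.exp (η 0 * G))).eventually_lt_const
      (show 0 * (G ^ 2 * Real.exp (η 0 * G)) < δ / 2 by rw [zero_mul]; exact half_pos hδ)
    have h3 := (tendsto_learningRate c x).eventually_lt_const
      (show 0 < c ^ 2 * (δ / 4) by positivity)
    filter_upwards [h2, h3, eventually_ge_atTop 1] with N h2 h3 hN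
    refine (mwu_regret_le η hη hanti g hg ha N).trans ?_
    have hN' : (1 : ℝ) ≤ N := by exact_mod_cast hN
    have h4 : (∑ n ∈ Finset.range N, η n) * (G ^ 2 * Real.exp (η 0 * G)) ≤ δ / 2 * N := by
      rw [inv_mul_eq_div, div_mul_eq_mul_div, div_lt_iff₀ (by linarith)] at h2
      exact h2.le
    have h5 : η N ^ 2 = c ^ 2 * (x / ((N + 1 : ℕ) : ℝ)) := by
      simp only [hηdef]
      rw [mul_pow, Real.sq_sqrt (by positivity)]
    -- Since `η N` is of order `1 / √N`, the term `log k / η N` is again a vanishing rate times `N`.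
    have h6 : x / η N = η N * ((N + 1 : ℕ) : ℝ) / c ^ 2 := by
      have := (hη N).ne'
      rw [div_eq_div_iff this (by positivity)]
      have h7 : η N * ((N + 1 : ℕ) : ℝ) * η N = η N ^ 2 * ((N + 1 : ℕ) : ℝ) := by ring
      rw [h7, h5]
      field_simp
    have h8 : x / η N ≤ δ / 2 * N := by
      rw [h6, div_le_iff₀ (by positivity)]
      push_cast
      have h9 : η N < c ^ 2 * (δ / 4) := h3
      have h10 := mul_le_mul h9.le (show (N : ℝ) + 1 ≤ 2 * N by linarith) (by positivity)
        (by positivity)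
      linarith
    linarith

/-- Numerator and normaliser each change by a factor of at most `exp r`; as probabilities are at
most one, the relative bound is also absolute. -/
lemma abs_mwu_sub_le {B : Finset A} (hB : B.Nonempty) {η η' r : ℝ} (hr : 0 ≤ r) (K K' : A → ℝ)
    (h : ∀ a ∈ B, |η * K a - η' * K' a| ≤ r) (a : A) :
    |mwu B η K a - mwu B η' K' a| ≤ Real.exp (2 * r) - 1 := by
  have key : ∀ (η η' : ℝ) (K K' : A → ℝ), (∀ a ∈ B, |η * K a - η' * K' a| ≤ r) → a ∈ B →
      mwu B η K a ≤ Real.exp (2 * r) * mwu B η' K' a := by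
    intro η η' K K' h ha
    have h1 : ∀ b ∈ B, Real.exp (-η' * K' b) ≤ Real.exp r * Real.exp (-η * K b) := by
      intro b hb
      rw [← Real.exp_add, Real.exp_le_exp]
      linarith [(abs_le.1 (h b hb)).2]
    have h2 : Real.exp (-η * K a) ≤ Real.exp r * Real.exp (-η' * K' a) := by
      rw [← Real.exp_add, Real.exp_le_exp]
      linarith [(abs_le.1 (h a ha)).1]
    have h3 : ∑ b ∈ B, Real.exp (-η' * K' b) ≤ Real.exp r * ∑ b ∈ B, Real.exp (-η * K b) := by
      rw [Finset.mul_sum]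
      exact Finset.sum_le_sum h1
    rw [mwu, mwu, if_pos ha, if_pos ha, mul_div_assoc', div_le_div_iff₀ (sum_exp_pos hB η K)
      (sum_exp_pos hB η' K'), two_mul, Real.exp_add]
    calc _ ≤ (Real.exp r * Real.exp (-η' * K' a)) *
          (Real.exp r * ∑ b ∈ B, Real.exp (-η * K b)) :=
          mul_le_mul h2 h3 (sum_exp_pos hB η' K').le (by positivity)
      _ = _ := by ring
  have hle : ∀ (η : ℝ) (K : A → ℝ), a ∈ B → mwu B η K a ≤ 1 := fun η K ha => by
    rw [← sum_mwu hB η K]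
    exact Finset.single_le_sum (f := mwu B η K) (fun b _ => mwu_nonneg B η K b) ha
  have he : 1 ≤ Real.exp (2 * r) := Real.one_le_exp (by linarith)
  by_cases ha : a ∈ B
  · have h1 := key η η' K K' h ha
    have h2 := key η' η K' K (fun b hb => by rw [abs_sub_comm]; exact h b hb) ha
    have h3 := mul_le_mul_of_nonneg_left (hle η K ha) (sub_nonneg.2 he)
    have h4 := mul_le_mul_of_nonneg_left (hle η' K' ha) (sub_nonneg.2 he)
    exact abs_le.2 ⟨by linarith, by linarith⟩
  · simp only [mwu, if_neg ha, sub_self, abs_zero]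
    linarith

lemma tendsto_rate_mul_sum_sub {G c x : ℝ} (hc : 0 < c) (g : ℕ → ℝ) (hg : ∀ n, |g n| ≤ G) :
    Tendsto (fun n : ℕ => c * √(x / ((n + 1 : ℕ) : ℝ)) * ∑ i ∈ Finset.range n, g i
      - c * √(x / ((n + 1 + 1 : ℕ) : ℝ)) * ∑ i ∈ Finset.range (n + 1), g i) atTop (𝓝 0) := by
  set η : ℕ → ℝ := fun n => c * √(x / ((n + 1 : ℕ) : ℝ)) with hη
  have hG : 0 ≤ G := (abs_nonneg _).trans (hg 0)
  have hη0 : ∀ n, 0 ≤ η n := fun n => by simp only [hη]; positivity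
  have hlim : Tendsto (fun n => 2 * G * η (n + 1)) atTop (𝓝 0) := by
    have := ((tendsto_add_atTop_iff_nat 1).2 (tendsto_learningRate c x)).const_mul (2 * G)
    rwa [mul_zero] at this
  -- The accumulated feedback may grow like `n`, so the decrease of the rate has to beat that
  -- growth. Because `η m ^ 2 * (m + 1)` is constant, this reduces to `(n + 2) * n ^ 2 ≤ (n + 1) ^
  -- 3`.
  have hdiff : ∀ n : ℕ, |η n - η (n + 1)| * n ≤ η (n + 1) := by
    intro n
    have hsq : ∀ m : ℕ, η m ^ 2 * (m + 1) = c ^ 2 * √x ^ 2 := fun m => by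
      have : (0 : ℝ) < ((m + 1 : ℕ) : ℝ) := by positivity
      simp only [hη]
      rw [Real.sqrt_div' x this.le, mul_pow, div_pow, Real.sq_sqrt this.le]
      push_cast at this ⊢
      field_simp
    have h1 := (hsq n).trans (hsq (n + 1)).symm
    push_cast at h1
    have hn : (0 : ℝ) ≤ n := n.cast_nonneg
    have h2 : η (n + 1) ≤ η n := by
      refine (pow_le_pow_iff_left₀ (hη0 _) (hη0 _) two_ne_zero).1 ?_
      nlinarith [sq_nonneg (η (n + 1))]
    rw [abs_of_nonneg (sub_nonneg.2 h2)]
    have h3 : η n * n ≤ η (n + 1) * (n + 1) := by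
      refine (pow_le_pow_iff_left₀ (by have := hη0 n; positivity)
        (by have := hη0 (n + 1); positivity) two_ne_zero).1 ?_
      refine le_of_mul_le_mul_right ?_ (show (0 : ℝ) < n + 1 by positivity)
      have h4 : (η n * n) ^ 2 * (n + 1) = η (n + 1) ^ 2 * ((n + 2) * (n : ℝ) ^ 2) := by
        linear_combination (n : ℝ) ^ 2 * h1
      have h5 : (η (n + 1) * (n + 1)) ^ 2 * (n + 1) = η (n + 1) ^ 2 * ((n : ℝ) + 1) ^ 3 := by ring
      rw [h4, h5]
      exact mul_le_mul_of_nonneg_left (by nlinarith [sq_nonneg (n : ℝ)]) (sq_nonneg _)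
    linarith
  refine squeeze_zero_norm (fun n => ?_) hlim
  have hK : |∑ i ∈ Finset.range n, g i| ≤ n * G := by
    refine (Finset.abs_sum_le_sum_abs _ _).trans ((Finset.sum_le_sum fun i _ => hg i).trans ?_)
    simp
  rw [Finset.sum_range_succ, Real.norm_eq_abs]
  change |η n * _ - η (n + 1) * _| ≤ _
  calc |η n * ∑ i ∈ Finset.range n, g i - η (n + 1) * (∑ i ∈ Finset.range n, g i + g n)|
      = |(η n - η (n + 1)) * ∑ i ∈ Finset.range n, g i - η (n + 1) * g n| := by ring_nf
    _ ≤ |η n - η (n + 1)| * (n * G) + η (n + 1) * G := by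
        refine (abs_sub _ _).trans ?_
        rw [abs_mul, abs_mul, abs_of_nonneg (hη0 (n + 1))]
        exact add_le_add (mul_le_mul_of_nonneg_left hK (abs_nonneg _))
          (mul_le_mul_of_nonneg_left (hg n) (hη0 _))
    _ ≤ 2 * G * η (n + 1) := by nlinarith [mul_le_mul_of_nonneg_right (hdiff n) hG]

/-- The strategies of multiplicative weights change slowly. -/
lemma tendsto_mwu_sub {B : Finset A} (hB : B.Nonempty) {G c : ℝ} (hc : 0 < c) (g : ℕ → A → ℝ)
    (hg : ∀ n a, |g n a| ≤ G) (a : A) :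
    Tendsto (fun n : ℕ => |mwu B (c * √(Real.log B.card / ((n + 1 : ℕ) : ℝ)))
        (fun b => ∑ i ∈ Finset.range n, g i b) a
      - mwu B (c * √(Real.log B.card / ((n + 1 + 1 : ℕ) : ℝ)))
        (fun b => ∑ i ∈ Finset.range (n + 1), g i b) a|) atTop (𝓝 0) := by
  have h1 := tendsto_finsetSum B fun b _ =>
    (tendsto_rate_mul_sum_sub (x := Real.log B.card) hc (fun n => g n b) (fun n => hg n b)).abs
  simp only [abs_zero, Finset.sum_const_zero] at h1
  have h2 := (((Real.continuous_exp.tendsto _).comp (h1.const_mul 2))).sub_const 1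
  simp only [mul_zero, Real.exp_zero, sub_self] at h2
  refine squeeze_zero (fun n => abs_nonneg _) (fun n => ?_) h2
  refine abs_mwu_sub_le hB (Finset.sum_nonneg fun _ _ => abs_nonneg _) _ _ (fun b hb => ?_) a
  exact Finset.single_le_sum (f := fun b => |c * √(Real.log B.card / ((n + 1 : ℕ) : ℝ)) *
    ∑ i ∈ Finset.range n, g i b - c * √(Real.log B.card / ((n + 1 + 1 : ℕ) : ℝ)) *
    ∑ i ∈ Finset.range (n + 1), g i b|) (fun _ _ => abs_nonneg _) hb

end MultiplicativeWeights

/-! ### Comparison of regrets, and approximate equilibria from regret bounds. -/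

namespace OMDP

variable {S A : Type*} [Fintype S] [Fintype A] {L : ℕ} {M : OMDP S A L}

variable (M) in
/-- The accumulated distance between the actual and the stationary (state, action) laws. -/
noncomputable def drift (π : ℕ → Policy S A) (T : ℕ) : ℝ :=
  ∑ t ∈ Finset.range T, ∑ x, |M.visit π t x - M.statDist (π t) x|

lemma sum_abs_visit_sub (π : ℕ → Policy S A) (t : ℕ) :
    ∑ x, |M.visit π t x - M.statDist (π t) x|
      = ∑ s, |M.stateLaw M.init π t s - M.statState (π t) s| :=
  sum_abs_jointLaw_sub _ _ _

/-- A geometric series; the bound depends on neither policy nor horizon, which allows uniformity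
over competitors. -/
lemma drift_const_le {τ : ℝ} (hτ : 0 < τ) (h : M.Mixing τ) (π : Policy S A) (T : ℕ) :
    M.drift (fun _ => π) T ≤ 2 * (1 - Real.exp (-1 / τ))⁻¹ := by
  have hs := summable_geometric_bound hτ 2
  calc M.drift (fun _ => π) T ≤ ∑ t ∈ Finset.range T, 2 * Real.exp (-1 / τ) ^ t := by
        refine Finset.sum_le_sum fun t _ => ?_
        rw [sum_abs_visit_sub]
        exact stateLaw_sub_statState hτ h π M.init.2 t
    _ ≤ ∑' t : ℕ, 2 * Real.exp (-1 / τ) ^ t := hs.sum_le_tsum _ fun t _ => by positivity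
    _ = _ := by
        rw [tsum_mul_left, tsum_geometric_of_lt_one (Real.exp_pos _).le (exp_rate_lt_one hτ)]

lemma eventually_drift_le {τ : ℝ} (hτ : 0 < τ) (h : M.Mixing τ) {π : ℕ → Policy S A}
    (hπ : Tendsto (fun t => ∑ s, ∑ a, |π t s a - π (t + 1) s a|) atTop (𝓝 0))
    {δ : ℝ} (hδ : 0 < δ) : ∀ᶠ T : ℕ in atTop, M.drift π T ≤ δ * T := by
  have h1 := (tendsto_stateLaw_sub_statState hτ h hπ).cesaro.eventually_lt_const hδ
  filter_upwards [h1, eventually_ge_atTop 1] with T h1 hT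
  have hT' : (0 : ℝ) < T := by exact_mod_cast hT
  rw [inv_mul_eq_div, div_lt_iff₀ hT'] at h1
  simpa only [drift, sum_abs_visit_sub] using h1.le

lemma abs_sum_visit_sub_le (π : ℕ → Policy S A) {l : ℕ → S × A → ℝ}
    (hl : ∀ t, l t ∈ M.lossSimplex) (T : ℕ) :
    |∑ t ∈ Finset.range T, l t ⬝ᵥ M.visit π t - ∑ t ∈ Finset.range T, l t ⬝ᵥ M.statDist (π t)|
      ≤ M.drift π T := by
  rw [← Finset.sum_sub_distrib]
  refine (Finset.abs_sum_le_sum_abs _ _).trans (Finset.sum_le_sum fun t _ => ?_)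
  simpa using abs_dotProduct_sub_le (lossSimplex_abs_le (hl t)) (M.visit π t) (M.statDist (π t))

lemma Adversary.loss_mem (adv : M.Adversary) (π : ℕ → Policy S A) (t : ℕ) :
    adv.loss π t ∈ M.lossSimplex := adv.choose_mem _ _

lemma Adversary.statRegret_le (adv : M.Adversary) (π : ℕ → Policy S A) (T : ℕ)
    {l : S × A → ℝ} (hl : l ∈ M.lossSimplex) :
    adv.statRegret π T l ≤ adv.regret π T l + 2 * M.drift π T := by
  have h1 := abs_le.1 (abs_sum_visit_sub_le π (fun _ => hl) T)
  have h2 := abs_le.1 (abs_sum_visit_sub_le π (adv.loss_mem π) T)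
  unfold statRegret regret
  linarith [h1.1, h2.2]

lemma sum_dotProduct_eq_avgLoss (adv : M.Adversary) (π : ℕ → Policy S A) {T : ℕ} (hT : 0 < T)
    (v : S × A → ℝ) :
    ∑ t ∈ Finset.range T, adv.loss π t ⬝ᵥ v = T * (adv.avgLoss π T ⬝ᵥ v) := by
  have : (T : ℝ) ≠ 0 := by exact_mod_cast hT.ne'
  rw [Adversary.avgLoss, smul_dotProduct, sum_dotProduct, smul_eq_mul, mul_inv_cancel_left₀ this]

lemma sum_dotProduct_eq_avgStat (π : ℕ → Policy S A) {T : ℕ} (hT : 0 < T)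
    (l : S × A → ℝ) :
    ∑ t ∈ Finset.range T, l ⬝ᵥ M.statDist (π t) = T * (l ⬝ᵥ M.avgStat π T) := by
  have : (T : ℝ) ≠ 0 := by exact_mod_cast hT.ne'
  rw [avgStat, dotProduct_smul, dotProduct_sum, smul_eq_mul, mul_inv_cancel_left₀ this]

lemma average_mem {E : Type*} [AddCommGroup E] [Module ℝ E] {K : Set E} (hK : Convex ℝ K)
    {u : ℕ → E} (hu : ∀ t, u t ∈ K) {T : ℕ} (hT : 0 < T) :
    (T : ℝ)⁻¹ • ∑ t ∈ Finset.range T, u t ∈ K := by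
  have : (T : ℝ) ≠ 0 := by exact_mod_cast hT.ne'
  rw [Finset.smul_sum]
  exact hK.sum_mem (fun _ _ => by positivity) (by simp [this]) fun t _ => hu t

lemma Adversary.avgLoss_mem (adv : M.Adversary) (π : ℕ → Policy S A) {T : ℕ} (hT : 0 < T) :
    adv.avgLoss π T ∈ M.lossSimplex :=
  average_mem (convex_convexHull ℝ _) (adv.loss_mem π) hT

/-- The quantity `T * ⟨avgLoss, d_π₀⟩` is both the agent's comparator total in the real play and the
adversary's comparator total when it faces `π₀` forever, so it cancels. -/
lemma Adversary.policyRegret_le (adv : M.Adversary) (π : ℕ → Policy S A) {T : ℕ} (hT : 0 < T)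
    (π₀ : Policy S A) :
    adv.policyRegret π T π₀ ≤ adv.agentStatRegret π T π₀
      + adv.statRegret (fun _ => π₀) T (adv.avgLoss π T)
      + M.drift π T + M.drift (fun _ => π₀) T := by
  have h1 := abs_le.1 (abs_sum_visit_sub_le π (adv.loss_mem π) T)
  have h2 := abs_le.1 (abs_sum_visit_sub_le (fun _ => π₀) (adv.loss_mem fun _ => π₀) T)
  have h3 := sum_dotProduct_eq_avgLoss adv π hT (M.statDist π₀)
  unfold policyRegret agentStatRegret statRegret
  rw [h3, Finset.sum_const, Finset.card_range, nsmul_eq_mul]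
  linarith [h1.2, h2.1]

/-- Adding the two regret bounds cancels the realised payoff and bounds the gap between any two
deviations; each equilibrium inequality takes one deviation to be the average strategy itself. -/
lemma isEpsNash_average [Nonempty A] {τ : ℝ} (hτ : 0 < τ) (h : M.Mixing τ) (adv : M.Adversary)
    (π : ℕ → Policy S A) {T : ℕ} (hT : 0 < T) {α β : ℝ}
    (hadv : ∀ l ∈ M.lossSimplex, adv.statRegret π T l ≤ α * T)
    (hagent : ∀ π₀, adv.agentStatRegret π T π₀ ≤ β * T) :
    M.IsEpsNash (α + β) (adv.avgLoss π T) (M.avgStat π T) := by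
  have hT' : (0 : ℝ) < T := by exact_mod_cast hT
  have key : ∀ l' ∈ M.lossSimplex, ∀ d' ∈ M.statSimplex,
      l' ⬝ᵥ M.avgStat π T - (α + β) ≤ adv.avgLoss π T ⬝ᵥ d' := by
    intro l' hl'
    have hconv : Convex ℝ {d' | l' ⬝ᵥ M.avgStat π T - (α + β) ≤ adv.avgLoss π T ⬝ᵥ d'} :=
      convex_halfSpace_ge ⟨fun x y => dotProduct_add _ x y, fun r x => dotProduct_smul r _ x⟩ _
    refine fun d' hd' => convexHull_min ?_ hconv hd'
    rintro _ ⟨b, rfl⟩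
    have h1 := hadv l' hl'
    have h2 := hagent (detPolicy b)
    unfold Adversary.statRegret at h1
    unfold Adversary.agentStatRegret at h2
    rw [sum_dotProduct_eq_avgStat π hT] at h1
    rw [sum_dotProduct_eq_avgLoss adv π hT (M.statDist _)] at h2
    rw [Set.mem_ofPred_eq]
    refine le_of_mul_le_mul_left ?_ hT'
    linarith
  have hl := adv.avgLoss_mem π hT
  have hd : M.avgStat π T ∈ M.statSimplex :=
    average_mem (convex_convexHull ℝ _) (fun t => statDist_mem_statSimplex hτ h (π t)) hT
  exact ⟨hl, hd, fun l' hl' => key l' hl' _ hd,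
    fun d' hd' => by linarith [key _ hl d' hd']⟩

/-- Approximate equilibria accumulate only at equilibria. -/
lemma eventually_exists_isEpsNash {ε : ℝ} {u v : ℕ → S × A → ℝ}
    (h : ∀ δ > 0, ∀ᶠ T in atTop, M.IsEpsNash (ε + δ) (u T) (v T)) {δ : ℝ} (hδ : 0 < δ) :
    ∀ᶠ T in atTop, ∃ l d, M.IsEpsNash ε l d ∧ dist (u T) l < δ ∧ dist (v T) d < δ := by
  by_contra hn
  -- The instance `δ = 1` only serves to place the subsequence in the compact strategy sets.
  obtain ⟨φ, hφ, hP⟩ := extraction_of_frequently_atTop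
    ((not_eventually.1 hn).and_eventually (h 1 one_pos))
  obtain ⟨⟨l, d⟩, hld, ψ, hψ, hlim⟩ := (M.lossSimplex_isCompact.prod
    M.statSimplex_isCompact).tendsto_subseq (x := fun n => (u (φ n), v (φ n)))
    fun n => ⟨(hP n).2.1, (hP n).2.2.1⟩
  have hu : Tendsto (fun n => u (φ (ψ n))) atTop (𝓝 l) := (continuous_fst.tendsto _).comp hlim
  have hv : Tendsto (fun n => v (φ (ψ n))) atTop (𝓝 d) := (continuous_snd.tendsto _).comp hlim
  have hdot : ∀ {x y : ℕ → S × A → ℝ} {x' y' : S × A → ℝ}, Tendsto x atTop (𝓝 x') →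
      Tendsto y atTop (𝓝 y') → Tendsto (fun n => x n ⬝ᵥ y n) atTop (𝓝 (x' ⬝ᵥ y')) := by
    intro x y x' y' hx hy
    exact ((continuous_fst.dotProduct continuous_snd).tendsto (x', y')).comp
      (hx.prodMk_nhds hy)
  have hsub : Tendsto (fun n => φ (ψ n)) atTop atTop := (hφ.comp hψ).tendsto_atTop
  have hN : M.IsEpsNash ε l d := by
    refine ⟨hld.1, hld.2, fun l' hl' => ?_, fun d' hd' => ?_⟩
    · refine le_of_forall_pos_le_add fun r hr => ?_
      have h1 := le_of_tendsto_of_tendsto ((hdot tendsto_const_nhds hv).sub_const (ε + r))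
        (hdot hu hv) ((hsub.eventually (h r hr)).mono fun n hn => hn.2.2.1 l' hl')
      linarith
    · refine le_of_forall_pos_le_add fun r hr => ?_
      have h1 := le_of_tendsto_of_tendsto (hdot hu hv)
        ((hdot hu tendsto_const_nhds).add_const (ε + r))
        ((hsub.eventually (h r hr)).mono fun n hn => hn.2.2.2 d' hd')
      linarith
  obtain ⟨n, h1, h2⟩ := ((Metric.tendsto_nhds.1 hu δ hδ).and (Metric.tendsto_nhds.1 hv δ hδ)).exists
  exact (hP (ψ n)).1 ⟨l, d, hN, h1, h2⟩

end OMDP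

/-! ### Runs of the algorithm: the last window and its regret. -/

namespace IsMDPOOE

open OMDP

variable {S A : Type*} [Fintype S] [Fintype A] [DecidableEq A] {L : ℕ} {M : OMDP S A L}
  {adv : M.Adversary} {ε c : ℝ} {br : ℕ → S → A} {E : ℕ → S → Finset A} {w : ℕ → ℕ}
  {π : ℕ → Policy S A}

lemma subset_succ (hrun : IsMDPOOE M adv ε c br E w π) (t : ℕ) (s : S) : E t s ⊆ E (t + 1) s := by
  by_cases hk : ∀ s, br t s ∈ E t s
  · rw [(hrun.keep t hk).1]
  · push Not at hk
    by_cases hs : br t s ∈ E t s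
    · rcases hrun.add_other t s hk hs with ⟨a, _, ha⟩ | ⟨h1, h2⟩
      · rw [ha]
        exact Finset.subset_insert _ _
      · rw [h2]
        exact Finset.subset_univ _
    · rw [hrun.add_new t s hs]
      exact Finset.subset_insert _ _

lemma sum_card_lt (hrun : IsMDPOOE M adv ε c br E w π) {t : ℕ} {s₀ : S}
    (h : br t s₀ ∉ E t s₀) : ∑ s, (E t s).card < ∑ s, (E (t + 1) s).card := by
  refine Finset.sum_lt_sum (fun s _ => Finset.card_le_card (hrun.subset_succ t s))
    ⟨s₀, Finset.mem_univ _, ?_⟩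
  rw [hrun.add_new t s₀ h, Finset.card_insert_of_notMem h]
  exact Nat.lt_succ_self _

/-- The total size of the effective sets is monotone and bounded, hence attains its maximum; a later
reset would exceed it. -/
lemma eventually_mem (hrun : IsMDPOOE M adv ε c br E w π) :
    ∃ N, ∀ t ≥ N, ∀ s, br t s ∈ E t s := by
  have hmono : Monotone fun t => ∑ s, (E t s).card := monotone_nat_of_le_succ fun t =>
    Finset.sum_le_sum fun s _ => Finset.card_le_card (hrun.subset_succ t s)
  have hbdd : ∀ t, ∑ s, (E t s).card ≤ ∑ _s : S, Fintype.card A := fun t =>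
    Finset.sum_le_sum fun s _ => Finset.card_le_univ _
  obtain ⟨N, hN⟩ : ∃ N, ∀ t ≥ N, ∑ s, (E t s).card = ∑ s, (E N s).card := by
    obtain ⟨_, ⟨N, rfl⟩, hm⟩ := (Set.range fun t => ∑ s, (E t s).card).exists_max_image id
      ((Set.finite_Iic _).subset (Set.range_subset_iff.2 hbdd)) (Set.range_nonempty _)
    exact ⟨N, fun t ht => le_antisymm (hm _ ⟨t, rfl⟩) (hmono ht)⟩
  refine ⟨N, fun t ht s => ?_⟩
  by_contra hn
  have := hrun.sum_card_lt hn
  rw [hN t ht, hN (t + 1) (by omega)] at this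
  exact lt_irrefl _ this

lemma window (hrun : IsMDPOOE M adv ε c br E w π) (t : ℕ) :
    ∀ i, w t ≤ i → i < t → w (i + 1) = w t ∧ E (i + 1) = E t := by
  induction t with
  | zero => exact fun i _ hi => absurd hi (Nat.not_lt_zero i)
  | succ t ih =>
    intro i hi hit
    rcases Nat.lt_succ_iff_lt_or_eq.1 hit with h | rfl
    · by_cases hk : ∀ s, br t s ∈ E t s
      · obtain ⟨h1, h2⟩ := hrun.keep t hk
        rw [h1, h2]
        exact ih i (h2 ▸ hi) h
      · push Not at hk
        rw [hrun.reset t hk] at hi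
        omega
    · exact ⟨rfl, rfl⟩

/-- After finitely many rounds the last time window has started. -/
lemma exists_last_window (hrun : IsMDPOOE M adv ε c br E w π) :
    ∃ W N F, (∀ i ≥ W, w (i + 1) = W ∧ E (i + 1) = F) ∧
      ∀ t ≥ N, w t = W ∧ ∀ s, br t s ∈ F s := by
  obtain ⟨N, hN⟩ := hrun.eventually_mem
  have hst : ∀ k, w (N + k) = w N ∧ E (N + k) = E N := by
    intro k
    induction k with
    | zero => exact ⟨rfl, rfl⟩
    | succ k ih =>
      have := hrun.keep (N + k) (hN _ (by omega))
      exact ⟨this.2.trans ih.1, this.1.trans ih.2⟩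
  refine ⟨w N, N, E N, fun i hi => ?_, fun t ht => ?_⟩
  · have h1 := hst (i + 1)
    -- The window may have begun before round `N`; looking back from a later time covers its early
    -- rounds too.
    have h2 := hrun.window (N + (i + 1)) i (h1.1 ▸ hi) (by omega)
    exact ⟨h2.1.trans h1.1, h2.2.trans h1.2⟩
  · obtain ⟨k, rfl⟩ := Nat.exists_eq_add_of_le ht
    exact ⟨(hst k).1, fun s => (hst k).2 ▸ hN _ ht s⟩

lemma play_eq (hrun : IsMDPOOE M adv ε c br E w π) {W : ℕ} {F : S → Finset A}
    (hW : ∀ i ≥ W, w (i + 1) = W ∧ E (i + 1) = F) (n : ℕ) (s : S) (a : A) :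
    π (W + n) s a = mwu (F s) (c * √(Real.log (F s).card / ((n + 1 : ℕ) : ℝ)))
      (fun a' => ∑ i ∈ Finset.range n,
        M.accLoss (π (W + i)) (adv.loss π (W + i)) s a') a := by
  obtain ⟨h1, h2⟩ := hW (W + n) (by omega)
  have h3 := hrun.play (W + n) s a
  rw [h1, h2] at h3
  simpa only [Nat.add_sub_cancel_left, Finset.sum_Ico_eq_sum_range] using h3

lemma tendsto_policy_sub (hrun : IsMDPOOE M adv ε c br E w π) (hc : 0 < c) {τ : ℝ} (hτ : 0 < τ)
    (h : M.Mixing τ) :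
    Tendsto (fun t => ∑ s, ∑ a, |π t s a - π (t + 1) s a|) atTop (𝓝 0) := by
  obtain ⟨W, N, F, hW, hN⟩ := hrun.exists_last_window
  rw [← tendsto_add_atTop_iff_nat W]
  have h1 := tendsto_finsetSum Finset.univ fun (s : S) _ =>
    tendsto_finsetSum Finset.univ fun (a : A) _ =>
      tendsto_mwu_sub ⟨_, (hN N le_rfl).2 s⟩ hc
        (fun i b => M.accLoss (π (W + i)) (adv.loss π (W + i)) s b)
        (fun i b => abs_accLoss_le hτ h _ (adv.loss_mem π _) s b) a
  simp only [Finset.sum_const_zero] at h1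
  refine h1.congr fun n => Finset.sum_congr rfl fun s _ => Finset.sum_congr rfl fun a _ => ?_
  rw [add_comm n W, add_assoc W n 1, hrun.play_eq hW, hrun.play_eq hW]

lemma sum_policy_mul (hrun : IsMDPOOE M adv ε c br E w π) {W : ℕ} {F : S → Finset A}
    (hW : ∀ i ≥ W, w (i + 1) = W ∧ E (i + 1) = F) (n : ℕ) (s : S) (f : A → ℝ) :
    ∑ a, π (W + n) s a * f a
      = ∑ a ∈ F s, mwu (F s) (c * √(Real.log (F s).card / ((n + 1 : ℕ) : ℝ)))
        (fun a' => ∑ i ∈ Finset.range n,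
          M.accLoss (π (W + i)) (adv.loss π (W + i)) s a') a * f a := by
  simp only [hrun.play_eq hW]
  refine (Finset.sum_subset (Finset.subset_univ _) fun a _ ha => ?_).symm
  rw [mwu, if_neg ha, zero_mul]

/-- In the last window the regret against effective deterministic policies is sublinear. -/
lemma eventually_window_regret_le (hrun : IsMDPOOE M adv ε c br E w π) (hc : 0 < c) {τ : ℝ}
    (hτ : 0 < τ) (h : M.Mixing τ) {W : ℕ} {F : S → Finset A}
    (hW : ∀ i ≥ W, w (i + 1) = W ∧ E (i + 1) = F) {δ : ℝ} (hδ : 0 < δ) :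
    ∀ᶠ n : ℕ in atTop, ∀ b : S → A, (∀ s, b s ∈ F s) →
      ∑ i ∈ Finset.range n, (adv.loss π (W + i) ⬝ᵥ M.statDist (π (W + i))
        - adv.loss π (W + i) ⬝ᵥ M.statDist (detPolicy b)) ≤ δ * n := by
  have h1 : ∀ᶠ n : ℕ in atTop, ∀ s, ∀ a ∈ F s, ∑ i ∈ Finset.range n,
      (∑ a', π (W + i) s a' * M.accLoss (π (W + i)) (adv.loss π (W + i)) s a'
        - M.accLoss (π (W + i)) (adv.loss π (W + i)) s a) ≤ δ * n := by
    rw [eventually_all]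
    intro s
    rw [eventually_all_finset]
    intro a ha
    simp only [hrun.sum_policy_mul hW]
    exact mwu_eventually_regret_le hc
      (fun i b => M.accLoss (π (W + i)) (adv.loss π (W + i)) s b)
      (fun i b => abs_accLoss_le hτ h _ (adv.loss_mem π _) s b) ha hδ
  filter_upwards [h1] with n h1 b hb
  have hm := statState_mem hτ h (detPolicy b)
  -- The weights in the performance difference belong to the fixed competitor `b`, not to round `i`,
  -- so the sum over rounds can be taken inside each state.
  calc _ = ∑ s, M.statState (detPolicy b) s * ∑ i ∈ Finset.range n,
      (∑ a', π (W + i) s a' * M.accLoss (π (W + i)) (adv.loss π (W + i)) s a'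
        - M.accLoss (π (W + i)) (adv.loss π (W + i)) s (b s)) := by
        simp only [Finset.mul_sum]
        rw [Finset.sum_comm]
        refine Finset.sum_congr rfl fun i _ => ?_
        rw [← neg_sub, statDist_sub_statDist hτ h, ← Finset.sum_neg_distrib]
        refine Finset.sum_congr rfl fun s _ => ?_
        rw [detPolicy_sum, ← mul_neg, neg_sub]
    _ ≤ ∑ s, M.statState (detPolicy b) s * (δ * n) :=
        Finset.sum_le_sum fun s _ => mul_le_mul_of_nonneg_left (h1 s _ (hb s)) (hm.1 s)
    _ = δ * n := by rw [← Finset.sum_mul, hm.2, one_mul]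

/-- The algorithm has `ε`-regret with respect to stationary distributions. -/
lemma eventually_agentStatRegret_le (hrun : IsMDPOOE M adv ε c br E w π) (hε : 0 ≤ ε)
    (hc : 0 < c) {τ : ℝ} (hτ : 0 < τ) (h : M.Mixing τ) {δ : ℝ} (hδ : 0 < δ) :
    ∀ᶠ T : ℕ in atTop, ∀ π₀ : Policy S A, adv.agentStatRegret π T π₀ ≤ (ε + δ) * T := by
  obtain ⟨W, N, F, hW, hN⟩ := hrun.exists_last_window
  have h1 := (tendsto_sub_atTop_nat W).eventually
    (hrun.eventually_window_regret_le hc hτ h hW (half_pos hδ))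
  have h2 : ∀ᶠ T : ℕ in atTop, (W : ℝ) ≤ δ / 2 * T :=
    (tendsto_natCast_atTop_atTop.const_mul_atTop (half_pos hδ)).eventually_ge_atTop _
  filter_upwards [h1, h2, eventually_ge_atTop N, eventually_gt_atTop W] with T h1 h2 hTN hTW π₀
  obtain ⟨hw, hbr⟩ := hN T hTN
  -- The competitor varies with `T`, so the window bound must hold for all effective `b`
  -- simultaneously.
  have h3 := h1 (br T) hbr
  have h4 := hrun.oracle T π₀
  rw [hw] at h4
  obtain ⟨n, rfl⟩ := Nat.exists_eq_add_of_le hTW.le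
  rw [Nat.add_sub_cancel_left] at h3 h4
  have hn : (0 : ℝ) < n := by exact_mod_cast (by omega : 0 < n)
  simp only [Finset.sum_Ico_eq_sum_range, Nat.add_sub_cancel_left, smul_dotProduct,
    sum_dotProduct, smul_eq_mul, inv_mul_eq_div] at h4
  rw [div_add' _ _ _ hn.ne', div_le_div_iff_of_pos_right hn] at h4
  have h5 : ∑ t ∈ Finset.range W, (adv.loss π t ⬝ᵥ M.statDist (π t)
      - adv.loss π t ⬝ᵥ M.statDist π₀) ≤ W := by
    refine (Finset.sum_le_card_nsmul _ _ 1 fun t _ => ?_).trans (by simp)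
    have hl := lossSimplex_mem_Icc (adv.loss_mem π t)
    linarith [(dotProduct_mem_Icc hl (statDist_mem hτ h (π t))).2,
      (dotProduct_mem_Icc hl (statDist_mem hτ h π₀)).1]
  rw [Finset.sum_sub_distrib] at h3
  rw [Adversary.agentStatRegret, ← Finset.sum_sub_distrib, Finset.sum_range_add,
    Finset.sum_sub_distrib (s := Finset.range n)]
  push_cast at h2 ⊢
  nlinarith [mul_nonneg hε (Nat.cast_nonneg (α := ℝ) W),
    mul_nonneg hδ.le (Nat.cast_nonneg (α := ℝ) W)]

end IsMDPOOE

theorem mainTheorem6 {S A : Type*} [Fintype S] [Fintype A] [DecidableEq A] {L : ℕ}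
    (M : OMDP S A L) (τ : ℝ) (hτ : 0 < τ) (hmix : M.Mixing τ) (adv : M.Adversary)
    (ε : ℝ) (hε : 0 ≤ ε) (c : ℝ) (hc : 0 < c)
    (br : ℕ → S → A) (E : ℕ → S → Finset A) (w : ℕ → ℕ) (π : ℕ → Policy S A)
    (hrun : IsMDPOOE M adv ε c br E w π) :
    -- if the adversary is no-regret, the average strategies converge to `ε`-Nash equilibria
    (adv.NoRegret →
      (∀ δ > 0, ∀ᶠ T : ℕ in atTop, M.IsEpsNash (ε + δ) (adv.avgLoss π T) (M.avgStat π T)) ∧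
      (∀ δ > 0, ∀ᶠ T : ℕ in atTop, ∃ l d, M.IsEpsNash ε l d ∧
        dist (adv.avgLoss π T) l < δ ∧ dist (M.avgStat π T) d < δ)) ∧
    -- `ε`-regret with respect to stationary distributions, against every adversary
    (∀ δ > 0, ∀ᶠ T : ℕ in atTop, ∀ π₀ : Policy S A,
      adv.agentStatRegret π T π₀ ≤ (ε + δ) * T) ∧
    -- policy regret at most `ε` against a no-regret adversary
    (adv.NoRegret → ∀ π₀ : Policy S A, ∀ δ > 0, ∀ᶠ T : ℕ in atTop,
      adv.policyRegret π T π₀ ≤ (ε + δ) * T) ∧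
    -- the same uniformly in the competing policy, if the adversary is uniformly no-regret
    (adv.UniformNoRegret → ∀ δ > 0, ∀ᶠ T : ℕ in atTop, ∀ π₀ : Policy S A,
      adv.policyRegret π T π₀ ≤ (ε + δ) * T) := by
  have : Nonempty S := by
    by_contra hS
    rw [not_nonempty_iff] at hS
    simpa using M.init.2.2
  have hA : Nonempty A := ⟨br 0 (Classical.arbitrary S)⟩
  have hdrift : ∀ δ > 0, ∀ᶠ T : ℕ in atTop, M.drift π T ≤ δ * T := fun δ hδ =>
    OMDP.eventually_drift_le hτ hmix (hrun.tendsto_policy_sub hc hτ hmix) hδ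
  have hagent : ∀ δ > 0, ∀ᶠ T : ℕ in atTop, ∀ π₀ : Policy S A,
      adv.agentStatRegret π T π₀ ≤ (ε + δ) * T := fun δ hδ =>
    hrun.eventually_agentStatRegret_le hε hc hτ hmix hδ
  have hconst : ∀ δ > 0, ∀ᶠ T : ℕ in atTop, ∀ π₀ : Policy S A,
      M.drift (fun _ => π₀) T ≤ δ * T := by
    intro δ hδ
    filter_upwards [(tendsto_natCast_atTop_atTop.const_mul_atTop hδ).eventually_ge_atTop
      (2 * (1 - Real.exp (-1 / τ))⁻¹)] with T hT π₀
    exact (OMDP.drift_const_le hτ hmix π₀ T).trans hT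
  have hnash : adv.NoRegret → ∀ δ > 0, ∀ᶠ T : ℕ in atTop,
      M.IsEpsNash (ε + δ) (adv.avgLoss π T) (M.avgStat π T) := by
    intro hadv δ hδ
    have h1 : ∀ᶠ T : ℕ in atTop, ∀ l ∈ M.lossSimplex, adv.statRegret π T l ≤ δ / 2 * T := by
      rcases hadv with hadv | hadv
      -- The drift enters twice: `δ / 4 + 2 * (δ / 8) = δ / 2`.
      · filter_upwards [hadv π (δ / 4) (by linarith), hdrift (δ / 8) (by linarith)]
          with T h1 h2 l hl
        linarith [adv.statRegret_le π T hl, h1 l hl]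
      · exact hadv π (δ / 2) (half_pos hδ)
    filter_upwards [h1, hagent (δ / 2) (half_pos hδ), eventually_gt_atTop 0] with T h1 h2 hT
    have := OMDP.isEpsNash_average hτ hmix adv π hT h1 h2
    rwa [show δ / 2 + (ε + δ / 2) = ε + δ by ring] at this
  refine ⟨fun hadv => ⟨hnash hadv, fun δ hδ =>
    OMDP.eventually_exists_isEpsNash (hnash hadv) hδ⟩, hagent, fun hadv π₀ δ hδ => ?_,
    fun hadv δ hδ => ?_⟩
  · have h1 : ∀ᶠ T : ℕ in atTop, ∀ l ∈ M.lossSimplex,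
        adv.statRegret (fun _ => π₀) T l ≤ δ / 4 * T := by
      rcases hadv with hadv | hadv
      -- The no-regret property is applied to the counterfactual play of `π₀`; its threshold may
      -- depend on `π₀`, whence the uniform hypothesis in the last claim.
      · filter_upwards [hadv (fun _ => π₀) (δ / 8) (by linarith), hconst (δ / 16) (by linarith)]
          with T h1 h2 l hl
        linarith [adv.statRegret_le (fun _ => π₀) T hl, h1 l hl, h2 π₀]
      · exact hadv _ _ (by linarith)
    filter_upwards [h1, hagent (δ / 4) (by linarith), hdrift (δ / 4) (by linarith),
      hconst (δ / 4) (by linarith), eventually_gt_atTop 0] with T h1 h2 h3 h4 hT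
    linarith [adv.policyRegret_le π hT π₀, h1 _ (adv.avgLoss_mem π hT), h2 π₀, h4 π₀]
  · have h1 : ∀ᶠ T : ℕ in atTop, ∀ π₀ : Policy S A, ∀ l ∈ M.lossSimplex,
        adv.statRegret (fun _ => π₀) T l ≤ δ / 4 * T := by
      rcases hadv with hadv | hadv
      · filter_upwards [hadv (δ / 8) (by linarith), hconst (δ / 16) (by linarith)]
          with T h1 h2 π₀ l hl
        linarith [adv.statRegret_le (fun _ => π₀) T hl, h1 (fun _ => π₀) l hl, h2 π₀]
      · filter_upwards [hadv (δ / 4) (by linarith)] with T h1 π₀ l hl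
        exact h1 _ l hl
    filter_upwards [h1, hagent (δ / 4) (by linarith), hdrift (δ / 4) (by linarith),
      hconst (δ / 4) (by linarith), eventually_gt_atTop 0] with T h1 h2 h3 h4 hT π₀
    linarith [adv.policyRegret_le π hT π₀, h1 π₀ _ (adv.avgLoss_mem π hT), h2 π₀, h4 π₀]
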